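/- All Hilbert spaces are finite dimensional, $|X|$ is the dimension of $X$, and $\log$ is to base $2$. $\|M\|_p := (\mathrm{Tr}\,(M^\dagger M)^{p/2})^{1/p}$ is the Schatten norm. A subnormalised density matrix is a positive semidefinite matrix of trace at most one. For a subnormalised density matrix $\alpha$ and a positive semidefinite $\beta$ on the same space let $$D_2(\alpha\|\beta) := 2\log\|\beta^{-1/4}\alpha\beta^{-1/4}\|_2 \ \text{ if } \mathrm{supp}(\alpha)\subseteq\mathrm{supp}(\beta), \qquad D_2(\alpha\|\beta) := +\infty \ \text{ otherwise},$$ where negative powers are taken on the support of $\beta$ and are zero on its orthogonal complement, and $\log 0=-\infty$. For $0<\epsilon<1$ let $$D_2^\epsilon(\alpha\|\beta) := \inf_{\alpha'} D_2(\alpha'\|\beta),$$ the infimum being over all subnormalised density matrices $\alpha'$ with $\|\alpha'-\alpha\|_1\le\epsilon\,\mathrm{Tr}\,\alpha$. For a subnormalised density matrix $\rho^{XY}$ with marginal $\rho^Y$ let $H_2^\epsilon(X|Y)_\rho := -D_2^\epsilon(\rho^{XY}\,\|\,1^X\otimes\rho^Y)$. **Theorem.** Let $k$ be a positive integer, let $A_1,\dots,A_k$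 be Hilbert spaces with $|A_i|\ge 2$, and let $B$, $R$ be Hilbert spaces. Let $\mathcal T^{A_1\cdots A_k\to B}$ be a completely positive trace non-increasing superoperator with Choi state $$\tau^{A'_1\cdots A'_kB} := (\mathcal T\otimes\mathbb I^{A'_1\cdots A'_k})(\Phi^{A'_1A_1}\otimes\cdots\otimes\Phi^{A'_kA_k}),\qquad \Phi^{A'A} := |A|^{-1}\sum_{a,b=1}^{|A|}|a,a\rangle\langle b,b|^{A'A},$$ where $A'_i$ is a copy of $A_i$ and $\mathbb I$ is the identity superoperator. Let $\rho^{A_1\cdots A_kR}$ be a subnormalised density matrix. For unitaries $U^{A_i}$ on $A_i$ let $$\sigma^{BR}(U^{A_1},\dots,U^{A_k}) := (\mathcal T\otimes\mathbb I^R)\big((U^{A_1}\otimes\cdots\otimes U^{A_k}\otimes 1^R)\,\rho\,(U^{A_1}\otimes\cdots\otimes U^{A_k}\otimes 1^R)^\dagger\big).$$ For $\emptyset\ne S\subseteq[k]$ let $A_S:=\bigotimes_{s\in S}A_s$, $A'_S:=\bigotimes_{s\in S}A'_s$ and $D_S := 2^{|S|-1}\prod_{s\in S}(1-|A_s|^{-2})^{-1/2}$.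 Let $0<\epsilon<1$. Then $$\mathbb E_{U^{A_1},\dots,U^{A_k}}\big[\|\sigma^{BR}(U^{A_1},\dots,U^{A_k})-\tau^B\otimes\rho^R\|_1\big] \le 2(3^k-1)\epsilon+\sum_{\emptyset\ne S\subseteq[k]}2^{|S|}D_S\cdot 2^{-\frac12H_2^\epsilon(A_S|R)_\rho-\frac12H_2^\epsilon(A'_S|B)_\tau},$$ where the expectation is over independent $U^{A_1},\dots,U^{A_k}$, each distributed according to the Haar probability measure on the unitary group of $A_i$, the entropies are those of the marginals $\rho^{A_SR}$ and $\tau^{A'_SB}$, and $2^{-\infty}=0$. -/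

import Mathlib

open MeasureTheory
open scoped Matrix Kronecker ENNReal ComplexOrder

noncomputable section

namespace Decoupling

/-! Finite-dimensional systems are represented by finite index types (an orthonormal basis), the
dimension `|A|` being `Fintype.card A`; operators are complex matrices, and the tensor product of
systems corresponds to the product of index types. -/

/-- The Schatten-`p` norm `‖M‖_p = (Tr (M† M)^{p/2})^{1/p}`. -/
def schattenNorm {X : Type*} [Fintype X] [DecidableEq X] (p : ℝ) (M : Matrix X X ℂ) : ℝ :=
  (cfc (fun x : ℝ => x ^ (p / 2)) (Mᴴ * M)).trace.re ^ (1 / p)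

/-- A subnormalised density matrix: positive semidefinite with trace at most one. -/
def IsSubnormalised {X : Type*} [Fintype X] (α : Matrix X X ℂ) : Prop :=
  α.PosSemidef ∧ α.trace.re ≤ 1

/-- The power `β ^ s` of a positive semidefinite matrix taken on the support of `β`, and zero on the
orthogonal complement of the support (Moore–Penrose convention for `s < 0`). -/
def suppPow {X : Type*} [Fintype X] [DecidableEq X] (β : Matrix X X ℂ) (s : ℝ) : Matrix X X ℂ :=
  cfc (fun x : ℝ => if x = 0 then 0 else x ^ s) β

/-- The support of a Hermitian matrix, i.e. the span of the eigenvectors with non-zero eigenvalue,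
which is its range. -/
def supp {X : Type*} [Fintype X] (M : Matrix X X ℂ) : Submodule ℂ (X → ℂ) :=
  LinearMap.range M.mulVecLin

/-- Logarithm to base two on the non-negative reals, with `log 0 = -∞`. -/
def elog2 (x : ℝ) : EReal :=
  if x ≤ 0 then ⊥ else ((Real.logb 2 x : ℝ) : EReal)

/-- The function `x ↦ 2 ^ x` on the extended reals, with `2 ^ (-∞) = 0` and `2 ^ (+∞) = +∞`. -/
def epow2 (x : EReal) : ℝ≥0∞ :=
  if x = ⊥ then 0 else if x = ⊤ then ⊤ else ENNReal.ofReal ((2 : ℝ) ^ x.toReal)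

open Classical in
/-- The Rényi-2 divergence `D₂(α‖β) = 2 log ‖β^{-1/4} α β^{-1/4}‖₂` if `supp α ≤ supp β`, and `+∞`
otherwise. -/
def renyiDiv {X : Type*} [Fintype X] [DecidableEq X] (α β : Matrix X X ℂ) : EReal :=
  if supp α ≤ supp β then
    2 * elog2 (schattenNorm 2 (suppPow β (-1 / 4) * α * suppPow β (-1 / 4)))
  else ⊤

/-- The smooth Rényi-2 divergence: the infimum of `D₂(α'‖β)` over the subnormalised density
matrices `α'` with `‖α' - α‖₁ ≤ ε Tr α`. -/
def smoothRenyiDiv {X : Type*} [Fintype X] [DecidableEq X] (ε : ℝ) (α β : Matrix X X ℂ) : EReal :=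
  ⨅ α' ∈ {α' : Matrix X X ℂ |
      IsSubnormalised α' ∧ schattenNorm 1 (α' - α) ≤ ε * α.trace.re},
    renyiDiv α' β

/-- Partial trace over the first system. -/
def traceFst {X Y : Type*} [Fintype X] (M : Matrix (X × Y) (X × Y) ℂ) : Matrix Y Y ℂ :=
  Matrix.of fun y y' => ∑ x, M (x, y) (x, y')

/-- The smooth conditional Rényi-2 entropy
`H₂^ε(X|Y)_ρ = - D₂^ε(ρ^{XY} ‖ 1^X ⊗ ρ^Y)` of a matrix on the systems `X Y`. -/
def smoothCondEntropy {X Y : Type*} [Fintype X] [DecidableEq X] [Fintype Y] [DecidableEq Y]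
    (ε : ℝ) (ρ : Matrix (X × Y) (X × Y) ℂ) : EReal :=
  -smoothRenyiDiv ε ρ ((1 : Matrix X X ℂ) ⊗ₖ traceFst ρ)

/-- The extension `T ⊗ I^R` of a superoperator `T : X → Y` by the identity on `R`. -/
def ampliate {X Y : Type*} (R : Type*)
    (T : Matrix X X ℂ →ₗ[ℂ] Matrix Y Y ℂ) (M : Matrix (X × R) (X × R) ℂ) :
    Matrix (Y × R) (Y × R) ℂ :=
  Matrix.of fun p q => T (Matrix.of fun x x' => M (x, p.2) (x', q.2)) p.1 q.1

/-- Complete positivity: `T ⊗ I` preserves positive semidefiniteness for every finite ancilla. -/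
def IsCompletelyPositive {X Y : Type*} [Fintype X] [Fintype Y]
    (T : Matrix X X ℂ →ₗ[ℂ] Matrix Y Y ℂ) : Prop :=
  ∀ (n : ℕ) (M : Matrix (X × Fin n) (X × Fin n) ℂ),
    M.PosSemidef → (ampliate (Fin n) T M).PosSemidef

/-- `T` does not increase the trace of positive semidefinite matrices. -/
def IsTraceNonincreasing {X Y : Type*} [Fintype X] [Fintype Y]
    (T : Matrix X X ℂ →ₗ[ℂ] Matrix Y Y ℂ) : Prop :=
  ∀ M : Matrix X X ℂ, M.PosSemidef → (T M).trace.re ≤ M.trace.re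

section Multipartite

variable {k : ℕ} {A : Fin k → Type*} [∀ i, Fintype (A i)] [∀ i, DecidableEq (A i)]

/-- The tensor product of a family of local operators, one for each `A i`. -/
def tensorOp (V : ∀ i, Matrix (A i) (A i) ℂ) : Matrix (∀ i, A i) (∀ i, A i) ℂ :=
  Matrix.of fun x y => ∏ i, V i (x i) (y i)

/-- The EPR state `|X|⁻¹ ∑_{a, b} |a, a⟩⟨b, b|`. -/
def epr (X : Type*) [Fintype X] [DecidableEq X] : Matrix (X × X) (X × X) ℂ :=
  Matrix.of fun p q => if p.1 = p.2 ∧ q.1 = q.2 then (Fintype.card X : ℂ)⁻¹ else 0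

/-- The tensor product of the EPR states of all pairs `A i, A' i`, as a matrix on
`(A 1 ⋯ A k) (A' 1 ⋯ A' k)`; here `A' i` is a copy of `A i`. -/
def eprAll (A : Fin k → Type*) [∀ i, Fintype (A i)] [∀ i, DecidableEq (A i)] :
    Matrix ((∀ i, A i) × (∀ i, A i)) ((∀ i, A i) × (∀ i, A i)) ℂ :=
  Matrix.of fun p q => ∏ i, epr (A i) (p.1 i, p.2 i) (q.1 i, q.2 i)

/-- The Choi state of `T : A 1 ⋯ A k → B`, as a matrix on `(A' 1 ⋯ A' k) B`. -/
def choiState {B : Type*} (T : Matrix (∀ i, A i) (∀ i, A i) ℂ →ₗ[ℂ] Matrix B B ℂ) :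
    Matrix ((∀ i, A i) × B) ((∀ i, A i) × B) ℂ :=
  (ampliate (∀ i, A i) T (eprAll A)).submatrix Prod.swap Prod.swap

/-- The marginal on `A_S C` of a matrix on `(A 1 ⋯ A k) C`: the partial trace over all `A i` with
`i ∉ S`. -/
def marginal {C : Type*} (S : Finset (Fin k))
    (M : Matrix ((∀ i, A i) × C) ((∀ i, A i) × C) ℂ) :
    Matrix ((∀ i : {i // i ∈ S}, A i) × C) ((∀ i : {i // i ∈ S}, A i) × C) ℂ :=
  Matrix.of fun p q => ∑ z : (∀ i : {i // ¬ i ∈ S}, A i),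
    M ((Equiv.piEquivPiSubtypeProd (· ∈ S) A).symm (p.1, z), p.2)
      ((Equiv.piEquivPiSubtypeProd (· ∈ S) A).symm (q.1, z), q.2)

/-- The unitarily perturbed state
`(T ⊗ I^R)((U 1 ⊗ ⋯ ⊗ U k ⊗ 1^R) ρ (U 1 ⊗ ⋯ ⊗ U k ⊗ 1^R)†)`. -/
def perturbedState {B R : Type*} [Fintype R] [DecidableEq R]
    (T : Matrix (∀ i, A i) (∀ i, A i) ℂ →ₗ[ℂ] Matrix B B ℂ)
    (ρ : Matrix ((∀ i, A i) × R) ((∀ i, A i) × R) ℂ)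
    (U : ∀ i, Matrix.unitaryGroup (A i) ℂ) : Matrix (B × R) (B × R) ℂ :=
  ampliate R T
    ((tensorOp (fun i => (U i : Matrix (A i) (A i) ℂ)) ⊗ₖ (1 : Matrix R R ℂ)) * ρ *
      (tensorOp (fun i => (U i : Matrix (A i) (A i) ℂ)) ⊗ₖ (1 : Matrix R R ℂ))ᴴ)

/-- `D_S = 2^{|S|-1} ∏_{s ∈ S} (1 - |A_s|^{-2})^{-1/2}`. -/
def coeffD (A : Fin k → Type*) [∀ i, Fintype (A i)] (S : Finset (Fin k)) : ℝ :=
  (2 : ℝ) ^ ((S.card : ℤ) - 1) *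
    ∏ s ∈ S, (1 - ((Fintype.card (A s) : ℝ) ^ 2)⁻¹) ^ (-1 / 2 : ℝ)

end Multipartite

section Haar

variable (X : Type*) [Fintype X] [DecidableEq X]

instance : MeasurableSpace (Matrix.unitaryGroup X ℂ) := borel _

instance : BorelSpace (Matrix.unitaryGroup X ℂ) := ⟨rfl⟩

instance : CompactSpace (Matrix.unitaryGroup X ℂ) := by
  refine isCompact_iff_compactSpace.mp ?_
  have hK : IsCompact (Set.pi Set.univ fun _ : X => Set.pi Set.univ fun _ : X =>
      Metric.closedBall (0 : ℂ) 1) :=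
    isCompact_univ_pi fun _ => isCompact_univ_pi fun _ => isCompact_closedBall _ _
  refine hK.of_isClosed_subset (isClosed_unitary (R := Matrix X X ℂ)) ?_
  intro U hU i _ j _
  simpa using entry_norm_bound_of_unitary hU i j

/-- The Haar probability measure on the unitary group: the Haar measure giving mass one to the whole
(compact) group. -/
def haarUnitary : Measure (Matrix.unitaryGroup X ℂ) :=
  Measure.haarMeasure ⊤

end Haar

end Decoupling

end

noncomputable section

namespace Decoupling

section SchattenNorm

variable {X : Type*} [Fintype X]

/-- The Frobenius norm. -/
def frobNorm {X Y : Type*} [Fintype X] [Fintype Y] (M : Matrix X Y ℂ) : ℝ :=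
  √(∑ i, ∑ j, ‖M i j‖ ^ 2)

lemma frobNorm_nonneg {X Y : Type*} [Fintype X] [Fintype Y] (M : Matrix X Y ℂ) :
    0 ≤ frobNorm M := Real.sqrt_nonneg _

lemma frobNorm_sq {X Y : Type*} [Fintype X] [Fintype Y] (M : Matrix X Y ℂ) :
    frobNorm M ^ 2 = ∑ i, ∑ j, ‖M i j‖ ^ 2 :=
  Real.sq_sqrt (by positivity)

lemma trace_conjTranspose_mul_self_re {X Y : Type*} [Fintype X] [Fintype Y] (M : Matrix X Y ℂ) :
    (Mᴴ * M).trace.re = frobNorm M ^ 2 := by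
  rw [frobNorm_sq, Finset.sum_comm]
  simp only [Matrix.trace, Matrix.diag, Matrix.mul_apply, Matrix.conjTranspose_apply, Complex.re_sum]
  refine Finset.sum_congr rfl fun i _ => Finset.sum_congr rfl fun j _ => ?_
  rw [RCLike.star_def, mul_comm, Complex.mul_conj, Complex.ofReal_re, Complex.normSq_eq_norm_sq]

lemma trace_mul_re_le {X Y : Type*} [Fintype X] [Fintype Y] (M : Matrix X Y ℂ)
    (N : Matrix Y X ℂ) : (M * N).trace.re ≤ frobNorm M * frobNorm N := by
  have h1 : (M * N).trace = ∑ p : X × Y, M p.1 p.2 * N p.2 p.1 := by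
    simp [Matrix.trace, Matrix.mul_apply, Fintype.sum_prod_type]
  have hM : frobNorm M = √(∑ p : X × Y, ‖M p.1 p.2‖ ^ 2) := by
    simp [frobNorm, Fintype.sum_prod_type]
  have hN : frobNorm N = √(∑ p : X × Y, ‖N p.2 p.1‖ ^ 2) := by
    rw [frobNorm, Finset.sum_comm]; simp [Fintype.sum_prod_type]
  rw [h1, hM, hN]
  refine (Complex.re_le_norm _).trans ((norm_sum_le _ _).trans ?_)
  simp only [norm_mul]
  exact Real.sum_mul_le_sqrt_mul_sqrt _ _ _

variable [DecidableEq X]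

lemma continuousOn_spectrum (f : ℝ → ℝ) (M : Matrix X X ℂ) :
    ContinuousOn f (spectrum ℝ M) :=
  (Matrix.finite_real_spectrum (A := M)).continuousOn f

lemma isHermitian_cfc (f : ℝ → ℝ) (M : Matrix X X ℂ) : (cfc f M).IsHermitian :=
  cfc_predicate f M

lemma cfc_mul_matrix (f g : ℝ → ℝ) (M : Matrix X X ℂ) :
    cfc (fun x => f x * g x) M = cfc f M * cfc g M :=
  cfc_mul f g M (continuousOn_spectrum f M) (continuousOn_spectrum g M)

lemma posSemidef_cfc {f : ℝ → ℝ} (hf : ∀ x, 0 ≤ f x) (M : Matrix X X ℂ) :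
    (cfc f M).PosSemidef := by
  have h : cfc f M = (cfc (fun x => √(f x)) M)ᴴ * cfc (fun x => √(f x)) M := by
    rw [(isHermitian_cfc _ M).eq, ← cfc_mul_matrix]
    congr 1; ext x; exact (Real.mul_self_sqrt (hf x)).symm
  rw [h]
  exact Matrix.posSemidef_conjTranspose_mul_self _

lemma schattenNorm_two (M : Matrix X X ℂ) : schattenNorm 2 M = frobNorm M := by
  have h : cfc (fun x : ℝ => x ^ ((2 : ℝ) / 2)) (Mᴴ * M) = Mᴴ * M := by
    have : (fun x : ℝ => x ^ ((2 : ℝ) / 2)) = fun x => x := by ext x; simp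
    rw [this]
    exact cfc_id' ℝ _ (Matrix.isHermitian_conjTranspose_mul_self M)
  rw [schattenNorm, h, trace_conjTranspose_mul_self_re, ← Real.sqrt_eq_rpow,
    Real.sqrt_sq (frobNorm_nonneg M)]

lemma schattenNorm_one {M : Matrix X X ℂ} (hM : M.IsHermitian) :
    schattenNorm 1 M = (cfc (fun x : ℝ => |x|) M).trace.re := by
  have h2 : Mᴴ * M = cfc (fun x : ℝ => x * x) M := by
    rw [cfc_mul_matrix, cfc_id' ℝ M hM.isSelfAdjoint, hM.eq]
  have h : cfc (fun x : ℝ => x ^ ((1 : ℝ) / 2)) (Mᴴ * M) = cfc (fun x : ℝ => |x|) M := by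
    rw [h2, ← cfc_comp' (fun x : ℝ => x ^ ((1 : ℝ) / 2)) (fun x => x * x) M
      (Set.Finite.continuousOn ((Matrix.finite_real_spectrum (A := M)).image _) _)
      (continuousOn_spectrum _ M) hM.isSelfAdjoint]
    congr 1; ext x
    rw [← Real.sqrt_eq_rpow, Real.sqrt_mul_self_eq_abs]
  rw [schattenNorm, h]; simp

/-- Jordan decomposition of a Hermitian matrix. -/
lemma exists_posSemidef_sub {M : Matrix X X ℂ} (hM : M.IsHermitian) :
    ∃ P N : Matrix X X ℂ, P.PosSemidef ∧ N.PosSemidef ∧ M = P - N ∧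
      schattenNorm 1 M = P.trace.re + N.trace.re := by
  refine ⟨cfc (fun x : ℝ => max x 0) M, cfc (fun x : ℝ => max (-x) 0) M,
    posSemidef_cfc (fun x => le_max_right _ _) M, posSemidef_cfc (fun x => le_max_right _ _) M,
    ?_, ?_⟩
  · rw [← cfc_sub _ _ M (continuousOn_spectrum _ M) (continuousOn_spectrum _ M)]
    conv_lhs => rw [← cfc_id' ℝ M hM.isSelfAdjoint]
    congr 1; ext x
    rcases le_total 0 x with h | h <;> simp [h]
  · rw [schattenNorm_one hM, ← Complex.add_re, ← Matrix.trace_add,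
      ← cfc_add (a := M) _ _ (continuousOn_spectrum _ M) (continuousOn_spectrum _ M)]
    congr 3; ext x
    rcases le_total 0 x with h | h <;> simp [h, abs_of_nonneg, abs_of_nonpos]

/-- The sign of a Hermitian matrix is a Hermitian unitary computing the trace norm. -/
lemma exists_sign {M : Matrix X X ℂ} (hM : M.IsHermitian) :
    ∃ C : Matrix X X ℂ, C.IsHermitian ∧ C * C = 1 ∧ schattenNorm 1 M = (C * M).trace.re := by
  refine ⟨cfc (fun x : ℝ => if x < 0 then -1 else 1) M, isHermitian_cfc _ M, ?_, ?_⟩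
  · rw [← cfc_mul_matrix]
    conv_rhs => rw [← cfc_const_one ℝ M hM.isSelfAdjoint]
    congr 1; ext x; split_ifs <;> simp
  · rw [schattenNorm_one hM]
    have : (fun x : ℝ => |x|) = fun x => (if x < 0 then -1 else 1) * x := by
      ext x; split_ifs with h
      · simp [abs_of_neg h]
      · simp [abs_of_nonneg (not_lt.1 h)]
    rw [this, cfc_mul_matrix, cfc_id' ℝ M hM.isSelfAdjoint]

lemma trace_mul_re_le_trace {C P : Matrix X X ℂ} (hC : C.IsHermitian) (hC1 : C * C = 1)
    (hP : P.PosSemidef) : (C * P).trace.re ≤ P.trace.re := by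
  have h := (hP.conjTranspose_mul_mul_same (1 - C)).trace_nonneg
  have h' : ((1 - C)ᴴ * P * (1 - C)).trace = 2 * (P.trace - (C * P).trace) := by
    rw [Matrix.conjTranspose_sub, hC.eq, Matrix.conjTranspose_one, Matrix.trace_mul_comm,
      ← mul_assoc, show (1 - C) * (1 - C) = (2 : ℂ) • (1 - C) by
        rw [sub_mul, mul_sub, mul_sub, hC1, two_smul]; simp; abel]
    simp [sub_mul, Matrix.trace_sub]
  rw [h', Complex.le_def] at h
  simpa using h.1

lemma schattenNorm_one_sub_le {P N : Matrix X X ℂ} (hP : P.PosSemidef) (hN : N.PosSemidef) :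
    schattenNorm 1 (P - N) ≤ P.trace.re + N.trace.re := by
  obtain ⟨C, hC, hC1, h⟩ := exists_sign (hP.isHermitian.sub hN.isHermitian)
  have hN' := trace_mul_re_le_trace hC.neg (by simpa using hC1) hN
  have hP' := trace_mul_re_le_trace hC hC1 hP
  rw [h, mul_sub, Matrix.trace_sub, Complex.sub_re]
  rw [neg_mul, Matrix.trace_neg, Complex.neg_re] at hN'
  linarith

lemma schattenNorm_one_add_le {M N : Matrix X X ℂ} (hM : M.IsHermitian) (hN : N.IsHermitian) :
    schattenNorm 1 (M + N) ≤ schattenNorm 1 M + schattenNorm 1 N := by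
  obtain ⟨P, Q, hP, hQ, h, h'⟩ := exists_posSemidef_sub hM
  obtain ⟨P₁, Q₁, hP₁, hQ₁, h₁, h₁'⟩ := exists_posSemidef_sub hN
  have := schattenNorm_one_sub_le (hP.add hP₁) (hQ.add hQ₁)
  rw [show P + P₁ - (Q + Q₁) = M + N by rw [h, h₁]; abel] at this
  simp only [Matrix.trace_add, Complex.add_re] at this
  linarith

lemma isHermitian_sum {Y ι : Type*} (s : Finset ι) {M : ι → Matrix Y Y ℂ}
    (hM : ∀ i ∈ s, (M i).IsHermitian) : (∑ i ∈ s, M i).IsHermitian := by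
  rw [Matrix.IsHermitian, Matrix.conjTranspose_sum]
  exact Finset.sum_congr rfl fun i hi => (hM i hi).eq

lemma schattenNorm_one_sum_le {ι : Type*} (s : Finset ι) {M : ι → Matrix X X ℂ}
    (hM : ∀ i ∈ s, (M i).IsHermitian) :
    schattenNorm 1 (∑ i ∈ s, M i) ≤ ∑ i ∈ s, schattenNorm 1 (M i) := by
  classical
  induction s using Finset.induction_on with
  | empty =>
    simpa using schattenNorm_one_sub_le (X := X) Matrix.PosSemidef.zero Matrix.PosSemidef.zero
  | insert i s hi ih =>
    rw [Finset.sum_insert hi, Finset.sum_insert hi]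
    have hs : ∀ j ∈ s, (M j).IsHermitian := fun j hj => hM j (Finset.mem_insert_of_mem hj)
    have := schattenNorm_one_add_le (hM i (Finset.mem_insert_self i s)) (isHermitian_sum s hs)
    have := ih hs
    linarith

/-- Hölder's inequality `‖G N G‖₁ ≤ (Tr G⁴)^{1/2} ‖N‖₂`. -/
lemma schattenNorm_one_conj_le {G N : Matrix X X ℂ} (hG : G.IsHermitian) (hN : N.IsHermitian) :
    schattenNorm 1 (G * N * G) ≤ √((G * G * (G * G)).trace.re) * frobNorm N := by
  have hH : (G * N * G).IsHermitian := by
    simpa [hG.eq] using Matrix.isHermitian_conjTranspose_mul_mul G hN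
  obtain ⟨C, hC, hC1, h⟩ := exists_sign hH
  have hsq : frobNorm (C * (G * G)) ^ 2 = (G * G * (G * G)).trace.re := by
    rw [← trace_conjTranspose_mul_self_re, Matrix.conjTranspose_mul, hC.eq,
      Matrix.conjTranspose_mul, hG.eq, mul_assoc (G * G), ← mul_assoc C, hC1, one_mul]
  have hGCG : frobNorm (G * C * G) ^ 2 ≤ frobNorm (C * (G * G)) ^ 2 := by
    rw [← trace_conjTranspose_mul_self_re]
    have : ((G * C * G)ᴴ * (G * C * G)).trace = (C * (G * G) * (C * (G * G))).trace := by
      rw [Matrix.conjTranspose_mul, Matrix.conjTranspose_mul, hC.eq, hG.eq,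
        Matrix.trace_mul_comm (C * (G * G)), mul_assoc G, Matrix.trace_mul_comm G]
      simp only [mul_assoc]
    rw [this, sq]
    exact trace_mul_re_le _ _
  calc schattenNorm 1 (G * N * G) = (G * C * G * N).trace.re := by
        rw [h, ← mul_assoc, Matrix.trace_mul_comm]
        simp only [mul_assoc]
    _ ≤ frobNorm (G * C * G) * frobNorm N := trace_mul_re_le _ _
    _ ≤ _ := by
        refine mul_le_mul_of_nonneg_right ?_ (frobNorm_nonneg N)
        rw [← hsq]
        exact Real.le_sqrt_of_sq_le hGCG

end SchattenNorm

section HaarMoments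

variable {X : Type*} [Fintype X] [DecidableEq X]

instance : IsProbabilityMeasure (haarUnitary X) := by
  refine ⟨?_⟩
  have h := Measure.haarMeasure_self
    (K₀ := (⊤ : TopologicalSpace.PositiveCompacts (Matrix.unitaryGroup X ℂ)))
  simpa [haarUnitary] using h

instance : (haarUnitary X).IsMulLeftInvariant := by
  unfold haarUnitary; infer_instance

instance : SecondCountableTopology (Matrix.unitaryGroup X ℂ) :=
  haveI : SecondCountableTopology (Matrix X X ℂ) :=
    inferInstanceAs (SecondCountableTopology (X → X → ℂ))
  TopologicalSpace.Subtype.secondCountableTopology _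

@[fun_prop]
lemma continuous_unitary_apply (a b : X) :
    Continuous fun U : Matrix.unitaryGroup X ℂ => (U : Matrix X X ℂ) a b :=
  (continuous_apply_apply a b).comp continuous_subtype_val

lemma integrable_of_continuous {E : Type*} [NormedAddCommGroup E] [SecondCountableTopology E]
    {f : Matrix.unitaryGroup X ℂ → E} (hf : Continuous f) : Integrable f (haarUnitary X) :=
  hf.integrable_of_hasCompactSupport (HasCompactSupport.of_compactSpace f)

/-- The moments `E[U_{ab} conj U_{a'b'}]`. -/
def moment₂ (b b' a a' : X) : ℂ :=
  ∫ U : Matrix.unitaryGroup X ℂ, U.1 a b * star (U.1 a' b') ∂haarUnitary X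

/-- The moments `E[U_{ab} conj U_{a'b'} conj U_{ce} U_{c'e'}]`. -/
def moment₄ (b b' e e' a a' c c' : X) : ℂ :=
  ∫ U : Matrix.unitaryGroup X ℂ,
    U.1 a b * (star (U.1 a' b') * (star (U.1 c e) * U.1 c' e')) ∂haarUnitary X

lemma moment₄_invariant (V : Matrix.unitaryGroup X ℂ) (b b' e e' a a' c c' : X) :
    moment₄ b b' e e' a a' c c' = ∑ i, V.1 a i * ∑ i', star (V.1 a' i') *
      ∑ j, star (V.1 c j) * ∑ j', V.1 c' j' * moment₄ b b' e e' i i' j j' := by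
  simp only [moment₄, Finset.mul_sum, ← integral_const_mul]
  rw [← integral_mul_left_eq_self _ V]
  have h : ∀ U : Matrix.unitaryGroup X ℂ,
      (V * U).1 a b * (star ((V * U).1 a' b') * (star ((V * U).1 c e) * (V * U).1 c' e')) =
      ∑ i, ∑ i', ∑ j, ∑ j', V.1 a i * (star (V.1 a' i') * (star (V.1 c j) * (V.1 c' j' *
        (U.1 i b * (star (U.1 i' b') * (star (U.1 j e) * U.1 j' e')))))) := by
    intro U
    have hm : ∀ x y, (V * U).1 x y = ∑ i, V.1 x i * U.1 i y := fun x y => Matrix.mul_apply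
    simp only [hm, star_sum, star_mul', Finset.sum_mul]
    simp only [Finset.mul_sum]
    refine Finset.sum_congr rfl fun i _ => Finset.sum_congr rfl fun i' _ =>
      Finset.sum_congr rfl fun j _ => Finset.sum_congr rfl fun j' _ => ?_
    ring
  simp only [h]
  rw [integral_finsetSum _ fun _ _ => integrable_of_continuous (by fun_prop)]
  refine Finset.sum_congr rfl fun i _ => ?_
  rw [integral_finsetSum _ fun _ _ => integrable_of_continuous (by fun_prop)]
  refine Finset.sum_congr rfl fun i' _ => ?_
  rw [integral_finsetSum _ fun _ _ => integrable_of_continuous (by fun_prop)]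
  refine Finset.sum_congr rfl fun j _ => ?_
  rw [integral_finsetSum _ fun _ _ => integrable_of_continuous (by fun_prop)]

lemma sum_mul_star_unitary (U : Matrix.unitaryGroup X ℂ) (b b' : X) :
    ∑ a, U.1 a b * star (U.1 a b') = if b = b' then 1 else 0 := by
  have h : ((star U.1 * U.1 : Matrix X X ℂ)) b' b = (1 : Matrix X X ℂ) b' b := by
    rw [Matrix.mem_unitaryGroup_iff'.1 U.2]
  rw [Matrix.mul_apply, Matrix.one_apply] at h
  simp only [Matrix.star_apply] at h
  simp only [mul_comm (U.1 _ b), h, eq_comm]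

/-- Diagonal unitary multiplying the coordinate `a` by `i`. -/
def phaseUnitary (a : X) : Matrix.unitaryGroup X ℂ :=
  ⟨Matrix.diagonal fun x => if x = a then Complex.I else 1, by
    rw [Matrix.mem_unitaryGroup_iff, Matrix.star_eq_conjTranspose, Matrix.diagonal_conjTranspose,
      Matrix.diagonal_mul_diagonal, ← Matrix.diagonal_one]
    congr 1; ext x; by_cases h : x = a <;> simp [h]⟩

/-- Permutation matrix. -/
def permUnitary (s : Equiv.Perm X) : Matrix.unitaryGroup X ℂ :=
  ⟨Matrix.of fun x y => if y = s x then 1 else 0, by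
    rw [Matrix.mem_unitaryGroup_iff]
    ext x y
    simp [Matrix.mul_apply, Matrix.one_apply, eq_comm]⟩

/-- The reflection with rows `(3/5, 4/5)` and `(4/5, -3/5)` in the plane of `a` and `c`. -/
def reflUnitary {a c : X} (hac : a ≠ c) : Matrix.unitaryGroup X ℂ :=
  ⟨1 - (2 / 5 : ℂ) • Matrix.vecMulVec (Pi.single a 1 - Pi.single c 2 : X → ℂ)
      (Pi.single a 1 - Pi.single c 2), by
    have hw : (Pi.single a 1 - Pi.single c 2 : X → ℂ) ⬝ᵥ (Pi.single a 1 - Pi.single c 2) = 5 := by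
      simp [hac, hac.symm]; norm_num
    have hs : star (Pi.single a 1 - Pi.single c 2 : X → ℂ) = Pi.single a 1 - Pi.single c 2 := by
      rw [star_sub, ← Pi.single_star, ← Pi.single_star]; simp
    rw [Matrix.mem_unitaryGroup_iff, Matrix.star_eq_conjTranspose, Matrix.conjTranspose_sub,
      Matrix.conjTranspose_smul, Matrix.conjTranspose_vecMulVec, hs, Matrix.conjTranspose_one,
      sub_mul, mul_sub, mul_sub, smul_mul_smul_comm, Matrix.vecMulVec_mul_vecMulVec, hw]
    ext i j
    simp
    ring⟩

lemma sum_reflUnitary_mul {a c : X} (hac : a ≠ c) (f : X → ℂ) :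
    ∑ i, (reflUnitary hac).1 a i * f i = 3 / 5 * f a + 4 / 5 * f c := by
  have : ∀ i, (reflUnitary hac).1 a i * f i =
      (if i = a then 3 / 5 * f a else 0) + (if i = c then 4 / 5 * f c else 0) := by
    intro i
    simp only [reflUnitary, Matrix.sub_apply, Matrix.smul_apply, Matrix.vecMulVec_apply,
      Matrix.one_apply, Pi.sub_apply, Pi.single_apply, smul_eq_mul]
    rcases eq_or_ne i a with rfl | h
    · have : (1 - 2 / 5 : ℂ) = 3 / 5 := by norm_num
      simp [hac, this]
    · rcases eq_or_ne i c with rfl | h'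
      · have : (2 / 5 * 2 : ℂ) = 4 / 5 := by norm_num
        simp [hac, hac.symm, this]
      · simp [hac, h, h', h.symm]
  simp [this, Finset.sum_add_distrib]

lemma phaseUnitary_mul_apply (x : X) (U : Matrix.unitaryGroup X ℂ) (a b : X) :
    (phaseUnitary x * U).1 a b = (if a = x then Complex.I else 1) * U.1 a b :=
  Matrix.diagonal_mul _ _ _ _

lemma permUnitary_mul_apply (s : Equiv.Perm X) (U : Matrix.unitaryGroup X ℂ) (a b : X) :
    (permUnitary s * U).1 a b = U.1 (s a) b := by
  have h : (permUnitary s * U).1 a b = ∑ i, (permUnitary s).1 a i * U.1 i b := Matrix.mul_apply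
  rw [h]; simp [permUnitary]

lemma moment₂_perm (s : Equiv.Perm X) (b b' a a' : X) :
    moment₂ b b' (s a) (s a') = moment₂ b b' a a' := by
  unfold moment₂
  conv_rhs => rw [← integral_mul_left_eq_self _ (permUnitary s)]
  simp only [permUnitary_mul_apply]

lemma moment₄_perm (s : Equiv.Perm X) (b b' e e' a a' c c' : X) :
    moment₄ b b' e e' (s a) (s a') (s c) (s c') = moment₄ b b' e e' a a' c c' := by
  unfold moment₄
  conv_rhs => rw [← integral_mul_left_eq_self _ (permUnitary s)]
  simp only [permUnitary_mul_apply]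

lemma moment₂_eq_zero (b b' : X) {a a' : X} (h : a ≠ a') : moment₂ b b' a a' = 0 := by
  have : moment₂ b b' a a' = Complex.I * moment₂ b b' a a' := by
    conv_lhs => rw [moment₂, ← integral_mul_left_eq_self _ (phaseUnitary a)]
    simp only [phaseUnitary_mul_apply]
    rw [moment₂, ← integral_const_mul]
    congr 1; ext U
    simp [h.symm, mul_assoc]
  have h1 : (1 - Complex.I) * moment₂ b b' a a' = 0 := by linear_combination this
  refine (mul_eq_zero.1 h1).resolve_left fun h => ?_
  simpa using congrArg Complex.re h

lemma moment₄_phase (x : X) (b b' e e' a a' c c' : X) :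
    moment₄ b b' e e' a a' c c' = (if a = x then Complex.I else 1) *
      (star (if a' = x then Complex.I else 1) * (star (if c = x then Complex.I else 1) *
      (if c' = x then Complex.I else 1))) * moment₄ b b' e e' a a' c c' := by
  conv_lhs => rw [moment₄, ← integral_mul_left_eq_self _ (phaseUnitary x)]
  simp only [phaseUnitary_mul_apply]
  rw [moment₄, ← integral_const_mul]
  congr 1; ext U
  simp only [star_mul']
  ring

lemma moment₄_eq_zero (b b' e e' : X) {a a' c c' : X} (h : ¬(a = a' ∧ c = c'))
    (h' : ¬(a = c ∧ a' = c')) : moment₄ b b' e e' a a' c c' = 0 := by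
  by_contra hne
  have key : ∀ x, (if a = x then Complex.I else 1) *
      (star (if a' = x then Complex.I else 1) * (star (if c = x then Complex.I else 1) *
      (if c' = x then Complex.I else 1))) = 1 := fun x =>
    mul_right_cancel₀ hne (by rw [one_mul]; exact (moment₄_phase x b b' e e' a a' c c').symm)
  by_cases h1 : a = a'
  · subst h1
    have hc : c ≠ c' := fun hc => h ⟨rfl, hc⟩
    have := key c'
    by_cases h2 : a = c' <;> simp [h2, hc, Complex.ext_iff] at this
  · by_cases h2 : a = c
    · subst h2
      have hc : a' ≠ c' := fun hc => h' ⟨rfl, hc⟩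
      have := key c'
      by_cases h2 : a = c' <;> simp [h2, hc, Complex.ext_iff] at this
    · have := key a
      by_cases h3 : c' = a <;>
        simp [h3, Ne.symm h1, Ne.symm h2, Complex.ext_iff] at this
      norm_num at this

lemma moment₂_eq (b b' a a' : X) :
    moment₂ b b' a a' =
      if a = a' ∧ b = b' then (Fintype.card X : ℂ)⁻¹ else 0 := by
  by_cases ha : a = a'
  swap
  · simp [ha, moment₂_eq_zero b b' ha]
  subst ha
  have hsum : ∑ x, moment₂ b b' x x = if b = b' then 1 else 0 := by
    unfold moment₂
    rw [← integral_finsetSum _ fun _ _ => integrable_of_continuous (by fun_prop)]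
    simp only [sum_mul_star_unitary, integral_const, probReal_univ, one_smul]
  have hconst : ∀ x, moment₂ b b' x x = moment₂ b b' a a := fun x => by
    simpa using moment₂_perm (Equiv.swap a x) b b' a a
  have hd : (Fintype.card X : ℂ) ≠ 0 := by
    have : Nonempty X := ⟨a⟩
    exact_mod_cast Fintype.card_ne_zero
  simp only [hconst, Finset.sum_const, Finset.card_univ, nsmul_eq_mul] at hsum
  simp only [true_and]
  rw [← mul_right_inj' hd, hsum]
  split_ifs <;> simp [hd]

omit [Fintype X] in
lemma exists_perm_map {x y a c : X} (hxy : x ≠ y) (hac : a ≠ c) :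
    ∃ s : Equiv.Perm X, s x = a ∧ s y = c := by
  refine ⟨Equiv.swap (Equiv.swap x a y) c * Equiv.swap x a, ?_, by simp⟩
  rw [Equiv.Perm.mul_apply, Equiv.swap_apply_left, Equiv.swap_apply_of_ne_of_ne _ hac]
  intro h
  exact hxy ((Equiv.swap x a).injective (by rw [Equiv.swap_apply_left, ← h]))

lemma moment₄_diag (b b' e e' : X) {x y : X} (hxy : x ≠ y) :
    moment₄ b b' e e' x x x x =
      moment₄ b b' e e' x x y y + moment₄ b b' e e' x y x y := by
  have hstar : ∀ i, star ((reflUnitary hxy).1 x i) = (reflUnitary hxy).1 x i := by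
    intro i
    simp only [reflUnitary, Matrix.sub_apply, Matrix.smul_apply, Matrix.vecMulVec_apply,
      Matrix.one_apply, Pi.sub_apply, Pi.single_apply, smul_eq_mul]
    split_ifs <;> simp
  have h := moment₄_invariant (reflUnitary hxy) b b' e e' x x x x
  simp only [hstar, sum_reflUnitary_mul] at h
  have hs : ∀ a a' c c', moment₄ b b' e e' (Equiv.swap x y a) (Equiv.swap x y a')
      (Equiv.swap x y c) (Equiv.swap x y c') = moment₄ b b' e e' a a' c c' :=
    moment₄_perm (Equiv.swap x y) b b' e e'
  have hp := hs x x x x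
  have hq := hs x x y y
  have hr := hs x y x y
  simp only [Equiv.swap_apply_left, Equiv.swap_apply_right] at hp hq hr
  have z : ∀ {a a' c c'}, ¬(a = a' ∧ c = c') → ¬(a = c ∧ a' = c') →
      moment₄ b b' e e' a a' c c' = 0 := fun h h' => moment₄_eq_zero b b' e e' h h'
  rw [hp, hq, hr, @z x x x y, @z x x y x, @z x y x x, @z x y y x, @z x y y y, @z y x x x,
    @z y x x y, @z y x y y, @z y y x y, @z y y y x] at h
  · linear_combination (625 / 288 : ℂ) * h
  all_goals simp [hxy, hxy.symm]

lemma moment₄_eq (b b' e e' : X) {x y : X} (hxy : x ≠ y) (a a' c c' : X) :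
    moment₄ b b' e e' a a' c c' =
      (if a = a' ∧ c = c' then moment₄ b b' e e' x x y y else 0) +
      (if a = c ∧ a' = c' then moment₄ b b' e e' x y x y else 0) := by
  by_cases h : a = a' ∧ c = c'
  · obtain ⟨rfl, rfl⟩ := h
    by_cases hac : a = c
    · subst hac
      have := moment₄_perm (Equiv.swap x a) b b' e e' x x x x
      rw [Equiv.swap_apply_left, moment₄_diag b b' e e' hxy] at this
      simpa using this
    · obtain ⟨s, rfl, rfl⟩ := exists_perm_map hxy hac
      simpa [hxy] using moment₄_perm s b b' e e' x x y y
  · by_cases h' : a = c ∧ a' = c'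
    · obtain ⟨rfl, rfl⟩ := h'
      have hac : a ≠ a' := fun hh => h ⟨hh, hh⟩
      obtain ⟨s, rfl, rfl⟩ := exists_perm_map hxy hac
      simpa [hxy] using moment₄_perm s b b' e e' x y x y
    · simp [h, h', moment₄_eq_zero b b' e e' h h']

lemma sum_moment₄_fst (b b' e e' c : X) :
    ∑ a, moment₄ b b' e e' a a c c =
      if b = b' ∧ e = e' then (Fintype.card X : ℂ)⁻¹ else 0 := by
  unfold moment₄
  rw [← integral_finsetSum _ fun _ _ => integrable_of_continuous (by fun_prop)]
  simp only [← mul_assoc, ← Finset.sum_mul, sum_mul_star_unitary]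
  simp only [mul_assoc, integral_const_mul, mul_comm (star _)]
  have := moment₂_eq e' e c c
  rw [moment₂] at this
  rw [this]
  by_cases h1 : b = b' <;> by_cases h2 : e = e' <;> simp [h1, h2, eq_comm]

lemma sum_moment₄_snd (b b' e e' c : X) :
    ∑ a, moment₄ b b' e e' a c a c =
      if b = e ∧ b' = e' then (Fintype.card X : ℂ)⁻¹ else 0 := by
  unfold moment₄
  rw [← integral_finsetSum _ fun _ _ => integrable_of_continuous (by fun_prop)]
  have h : ∀ (U : Matrix.unitaryGroup X ℂ) (a : X),
      U.1 a b * (star (U.1 c b') * (star (U.1 a e) * U.1 c e')) =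
      U.1 a b * star (U.1 a e) * (U.1 c e' * star (U.1 c b')) := fun U a => by ring
  simp only [h, ← Finset.sum_mul, sum_mul_star_unitary, integral_const_mul]
  have := moment₂_eq e' b' c c
  rw [moment₂] at this
  rw [this]
  by_cases h1 : b = e <;> by_cases h2 : b' = e' <;> simp [h1, h2, eq_comm]

/-- The centred matrix coefficient `U_{ab} conj U_{a'b'} - E[U_{ab} conj U_{a'b'}]` of
conjugation by `U`, as a matrix in `(a, b), (a', b')`. -/
def centredKernel (U : Matrix X X ℂ) : Matrix (X × X) (X × X) ℂ :=
  Matrix.of (fun p q => U p.1 p.2 * star (U q.1 q.2)) - (Fintype.card X : ℂ)⁻¹ • 1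

/-- The covariance of the matrix coefficients of conjugation by a Haar random unitary. -/
lemma integral_centredKernel (hX : 2 ≤ Fintype.card X) (a a' b b' c c' e e' : X) :
    ∫ U : Matrix.unitaryGroup X ℂ, centredKernel U.1 (a, b) (a', b') *
        star (centredKernel U.1 (c, e) (c', e')) ∂haarUnitary X =
      ((Fintype.card X : ℂ) ^ 2 - 1)⁻¹ *
        ((1 - epr X) (a, a') (c, c') * (1 - epr X) (b, b') (e, e')) := by
  obtain ⟨x, y, hxy⟩ := Fintype.one_lt_card_iff.1 hX
  set d : ℂ := (Fintype.card X : ℂ) with hd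
  have hd0 : d ≠ 0 := by rw [hd]; exact_mod_cast (by omega : Fintype.card X ≠ 0)
  have hd1 : d ^ 2 - 1 ≠ 0 := by
    have h : ((Fintype.card X ^ 2 - 1 : ℕ) : ℂ) ≠ 0 := by
      have : 2 ^ 2 ≤ Fintype.card X ^ 2 := Nat.pow_le_pow_left hX 2
      exact_mod_cast (by omega)
    rwa [Nat.cast_sub (Nat.one_le_pow _ _ (by omega)), Nat.cast_pow, Nat.cast_one] at h
  obtain ⟨q, r, hm⟩ : ∃ q r, ∀ a a' c c', moment₄ b b' e e' a a' c c' =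
      (if a = a' ∧ c = c' then q else 0) + (if a = c ∧ a' = c' then r else 0) :=
    ⟨_, _, moment₄_eq b b' e e' hxy⟩
  have h1 := sum_moment₄_fst b b' e e' x
  have h2 := sum_moment₄_snd b b' e e' x
  simp only [hm] at h1 h2
  simp [Finset.sum_add_distrib, ← hd] at h1 h2
  have hK : ∀ (U : Matrix X X ℂ) (x y x' y' : X), centredKernel U (x, y) (x', y') =
      U x y * star (U x' y') - moment₂ y y' x x' := by
    intro U x y x' y'
    simp [centredKernel, moment₂_eq, Matrix.one_apply]
  have hst : star (moment₂ e e' c c') = moment₂ e' e c' c := by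
    rw [moment₂_eq, moment₂_eq]
    simp only [eq_comm (a := c), eq_comm (a := e)]
    split_ifs <;> simp
  have hint : ∫ U : Matrix.unitaryGroup X ℂ, centredKernel U.1 (a, b) (a', b') *
      star (centredKernel U.1 (c, e) (c', e')) ∂haarUnitary X =
      moment₄ b b' e e' a a' c c' - moment₂ b b' a a' * moment₂ e' e c' c := by
    have hexp : ∀ U : Matrix.unitaryGroup X ℂ, centredKernel U.1 (a, b) (a', b') *
        star (centredKernel U.1 (c, e) (c', e')) =
        U.1 a b * (star (U.1 a' b') * (star (U.1 c e) * U.1 c' e')) -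
        moment₂ e' e c' c * (U.1 a b * star (U.1 a' b')) -
        (moment₂ b b' a a' * (U.1 c' e' * star (U.1 c e)) -
          moment₂ b b' a a' * moment₂ e' e c' c) := by
      intro U
      rw [hK, hK, star_sub, star_mul', star_star, hst]
      ring
    simp only [hexp]
    rw [integral_sub, integral_sub, integral_sub, integral_const_mul, integral_const_mul,
      integral_const]
    · change moment₄ b b' e e' a a' c c' - moment₂ e' e c' c * moment₂ b b' a a' -
        (moment₂ b b' a a' * moment₂ e' e c' c - _) = _
      simp
      ring
    all_goals exact integrable_of_continuous (by fun_prop)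
  rw [hint, hm, moment₂_eq, moment₂_eq, ← mul_right_inj' hd1, mul_inv_cancel_left₀ hd1]
  simp only [Matrix.sub_apply, Matrix.one_apply, epr, Matrix.of_apply, Prod.mk.injEq, ← hd]
  have ht : (if a = a' ∧ b = b' then d⁻¹ else 0) * (if c' = c ∧ e' = e then d⁻¹ else 0) =
      (if a = a' ∧ c = c' then d⁻¹ else 0) * (if b = b' ∧ e = e' then d⁻¹ else 0) := by
    by_cases h1 : a = a' <;> by_cases h2 : b = b' <;> by_cases h3 : c = c' <;>
      by_cases h4 : e = e' <;> simp [h1, h2, h3, h4, eq_comm]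
  have e1 : ∀ (p : Prop) [Decidable p] (z : ℂ), (if p then z else 0) = z * if p then 1 else 0 :=
    fun p _ z => by split_ifs <;> simp
  rw [ht]
  simp only [e1 _ q, e1 _ r, e1 _ d⁻¹] at h1 h2 ⊢
  generalize (if a = a' ∧ c = c' then (1 : ℂ) else 0) = t₁ at *
  generalize (if a = c ∧ a' = c' then (1 : ℂ) else 0) = t₂ at *
  generalize (if b = b' ∧ e = e' then (1 : ℂ) else 0) = s₁ at *
  generalize (if b = e ∧ b' = e' then (1 : ℂ) else 0) = s₂ at *
  have hr : r * (d ^ 2 - 1) = s₂ - d⁻¹ * s₁ := by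
    linear_combination d * h2 - h1 + (mul_inv_cancel₀ hd0) * s₂
  have hq : q * (d ^ 2 - 1) = s₁ - d⁻¹ * s₂ := by
    linear_combination d * h1 - h2 + (mul_inv_cancel₀ hd0) * s₁
  linear_combination t₁ * hq + t₂ * hr - t₁ * s₁ * (d * d⁻¹ + 1) * (mul_inv_cancel₀ hd0)

end HaarMoments

section Link

variable {X Y B R : Type*} [Fintype X] [Fintype Y]

/-- The contraction of the operators `τ` on `X B` and `ρ` on `Y R` along the operator `F` on
`X Y`. -/
def link (τ : Matrix (X × B) (X × B) ℂ) (F : Matrix (X × Y) (X × Y) ℂ)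
    (ρ : Matrix (Y × R) (Y × R) ℂ) : Matrix (B × R) (B × R) ℂ :=
  Matrix.of fun p q => ∑ k : X × Y, ∑ k' : X × Y,
    τ (k.1, p.1) (k'.1, q.1) * F k k' * ρ (k.2, p.2) (k'.2, q.2)

lemma link_add_left (τ τ' : Matrix (X × B) (X × B) ℂ) (F : Matrix (X × Y) (X × Y) ℂ)
    (ρ : Matrix (Y × R) (Y × R) ℂ) : link (τ + τ') F ρ = link τ F ρ + link τ' F ρ := by
  ext p q
  simp only [link, Matrix.of_apply, Matrix.add_apply, add_mul, Finset.sum_add_distrib]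

lemma link_sub_left (τ τ' : Matrix (X × B) (X × B) ℂ) (F : Matrix (X × Y) (X × Y) ℂ)
    (ρ : Matrix (Y × R) (Y × R) ℂ) : link (τ - τ') F ρ = link τ F ρ - link τ' F ρ := by
  ext p q
  simp only [link, Matrix.of_apply, Matrix.sub_apply, sub_mul, Finset.sum_sub_distrib]

lemma link_add_mid (τ : Matrix (X × B) (X × B) ℂ) (F F' : Matrix (X × Y) (X × Y) ℂ)
    (ρ : Matrix (Y × R) (Y × R) ℂ) : link τ (F + F') ρ = link τ F ρ + link τ F' ρ := by
  ext p q
  simp only [link, Matrix.of_apply, Matrix.add_apply, add_mul, mul_add, Finset.sum_add_distrib]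

lemma link_sub_mid (τ : Matrix (X × B) (X × B) ℂ) (F F' : Matrix (X × Y) (X × Y) ℂ)
    (ρ : Matrix (Y × R) (Y × R) ℂ) : link τ (F - F') ρ = link τ F ρ - link τ F' ρ := by
  ext p q
  simp only [link, Matrix.of_apply, Matrix.sub_apply, sub_mul, mul_sub, Finset.sum_sub_distrib]

lemma link_add_right (τ : Matrix (X × B) (X × B) ℂ) (F : Matrix (X × Y) (X × Y) ℂ)
    (ρ ρ' : Matrix (Y × R) (Y × R) ℂ) : link τ F (ρ + ρ') = link τ F ρ + link τ F ρ' := by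
  ext p q
  simp only [link, Matrix.of_apply, Matrix.add_apply, mul_add, Finset.sum_add_distrib]

lemma link_sub_right (τ : Matrix (X × B) (X × B) ℂ) (F : Matrix (X × Y) (X × Y) ℂ)
    (ρ ρ' : Matrix (Y × R) (Y × R) ℂ) : link τ F (ρ - ρ') = link τ F ρ - link τ F ρ' := by
  ext p q
  simp only [link, Matrix.of_apply, Matrix.sub_apply, mul_sub, Finset.sum_sub_distrib]

lemma link_sum_mid {ι : Type*} (s : Finset ι) (τ : Matrix (X × B) (X × B) ℂ)
    (F : ι → Matrix (X × Y) (X × Y) ℂ) (ρ : Matrix (Y × R) (Y × R) ℂ) :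
    link τ (∑ i ∈ s, F i) ρ = ∑ i ∈ s, link τ (F i) ρ := by
  classical
  induction s using Finset.induction_on with
  | empty => ext p q; simp [link]
  | insert i s hi ih => rw [Finset.sum_insert hi, Finset.sum_insert hi, link_add_mid, ih]

lemma conjTranspose_link (τ : Matrix (X × B) (X × B) ℂ) (F : Matrix (X × Y) (X × Y) ℂ)
    (ρ : Matrix (Y × R) (Y × R) ℂ) : (link τ F ρ)ᴴ = link τᴴ Fᴴ ρᴴ := by
  ext p q
  simp only [link, Matrix.of_apply, Matrix.conjTranspose_apply, star_sum, star_mul']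
  rw [Finset.sum_comm]

variable [Fintype B] [Fintype R]

lemma posSemidef_sum_blocks {K P : Type*} [Fintype K] [Fintype P]
    {M : Matrix (K × P) (K × P) ℂ} (hM : M.PosSemidef) :
    (Matrix.of fun p q => ∑ k, ∑ k', M (k, p) (k', q) : Matrix P P ℂ).PosSemidef := by
  classical
  have h := hM.conjTranspose_mul_mul_same
    (Matrix.of fun z q => if z.2 = q then 1 else 0 : Matrix (K × P) P ℂ)
  convert h using 1
  ext p q
  simp only [Matrix.mul_apply, Matrix.conjTranspose_apply, Matrix.of_apply,
    Fintype.sum_prod_type, mul_ite, mul_one, mul_zero, Finset.sum_ite_eq', Finset.mem_univ, if_true,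
    apply_ite (star : ℂ → ℂ), star_one, star_zero, ite_mul, one_mul, zero_mul]
  rw [Finset.sum_comm]

lemma posSemidef_link {τ : Matrix (X × B) (X × B) ℂ} {F : Matrix (X × Y) (X × Y) ℂ}
    {ρ : Matrix (Y × R) (Y × R) ℂ} (hτ : τ.PosSemidef) (hF : F.PosSemidef) (hρ : ρ.PosSemidef) :
    (link τ F ρ).PosSemidef := by
  classical
  let M : Matrix ((X × Y) × (B × R)) ((X × Y) × (B × R)) ℂ := ((τ ⊗ₖ F) ⊗ₖ ρ).submatrix
    (fun z => (((z.1.1, z.2.1), z.1), (z.1.2, z.2.2)))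
    (fun z => (((z.1.1, z.2.1), z.1), (z.1.2, z.2.2)))
  have hM : M.PosSemidef := ((hτ.kronecker hF).kronecker hρ).submatrix _
  have h : link τ F ρ = Matrix.of fun p q => ∑ k, ∑ k', M (k, p) (k', q) := by
    ext p q
    simp only [link, M, Matrix.of_apply, Matrix.submatrix_apply, Matrix.kroneckerMap_apply]
  rw [h]
  exact posSemidef_sum_blocks hM

lemma schattenNorm_one_link_le [DecidableEq B] [DecidableEq R]
    {τ₁ τ₂ : Matrix (X × B) (X × B) ℂ} {F₁ F₂ : Matrix (X × Y) (X × Y) ℂ}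
    {ρ₁ ρ₂ : Matrix (Y × R) (Y × R) ℂ} (hτ₁ : τ₁.PosSemidef) (hτ₂ : τ₂.PosSemidef)
    (hF₁ : F₁.PosSemidef) (hF₂ : F₂.PosSemidef) (hρ₁ : ρ₁.PosSemidef) (hρ₂ : ρ₂.PosSemidef) :
    schattenNorm 1 (link (τ₁ - τ₂) (F₁ - F₂) (ρ₁ - ρ₂)) ≤
      (link (τ₁ + τ₂) (F₁ + F₂) (ρ₁ + ρ₂)).trace.re := by
  have h := schattenNorm_one_sub_le
    ((((posSemidef_link hτ₁ hF₁ hρ₁).add (posSemidef_link hτ₁ hF₂ hρ₂)).add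
      (posSemidef_link hτ₂ hF₁ hρ₂)).add (posSemidef_link hτ₂ hF₂ hρ₁))
    ((((posSemidef_link hτ₁ hF₁ hρ₂).add (posSemidef_link hτ₁ hF₂ hρ₁)).add
      (posSemidef_link hτ₂ hF₁ hρ₁)).add (posSemidef_link hτ₂ hF₂ hρ₂))
  rw [← Complex.add_re, ← Matrix.trace_add] at h
  convert h using 3
  · simp only [link_sub_left, link_sub_mid, link_sub_right]; abel
  · simp only [link_add_left, link_add_mid, link_add_right]; abel

lemma trace_link (τ : Matrix (X × B) (X × B) ℂ) (F : Matrix (X × Y) (X × Y) ℂ)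
    (ρ : Matrix (Y × R) (Y × R) ℂ) :
    (link τ F ρ).trace = ∑ k, ∑ k', (∑ p : B × R, τ (k.1, p.1) (k'.1, p.1) *
      ρ (k.2, p.2) (k'.2, p.2)) * F k k' := by
  simp only [Matrix.trace, Matrix.diag, link, Matrix.of_apply]
  rw [Finset.sum_comm]
  refine Finset.sum_congr rfl fun k _ => ?_
  rw [Finset.sum_comm]
  refine Finset.sum_congr rfl fun k' _ => ?_
  rw [Finset.sum_mul]
  exact Finset.sum_congr rfl fun p _ => by ring

lemma trace_link_one [DecidableEq X] [DecidableEq Y] (τ : Matrix (X × B) (X × B) ℂ) (s : ℂ)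
    (ρ : Matrix (Y × R) (Y × R) ℂ) :
    (link τ (s • 1) ρ).trace = s * (τ.trace * ρ.trace) := by
  rw [trace_link]
  simp only [Matrix.smul_apply, Matrix.one_apply, smul_eq_mul, mul_ite, mul_one, mul_zero,
    Finset.sum_ite_eq, Finset.mem_univ, if_true, Matrix.trace, Matrix.diag, Fintype.sum_prod_type,
    ← Finset.mul_sum, ← Finset.sum_mul, mul_comm _ s]

lemma one_kronecker_mul_apply [DecidableEq X] {Z : Type*} (G : Matrix B B ℂ)
    (τ : Matrix (X × B) Z ℂ) (p : X × B) (z : Z) :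
    (((1 : Matrix X X ℂ) ⊗ₖ G) * τ) p z = ∑ b, G p.2 b * τ (p.1, b) z := by
  simp [Matrix.mul_apply, Fintype.sum_prod_type, Matrix.one_apply]

lemma link_kronecker_mul [DecidableEq X] [DecidableEq Y] (τ : Matrix (X × B) (X × B) ℂ)
    (F : Matrix (X × Y) (X × Y) ℂ) (ρ : Matrix (Y × R) (Y × R) ℂ) (G : Matrix B B ℂ)
    (H : Matrix R R ℂ) :
    link ((1 ⊗ₖ G) * τ) F ((1 ⊗ₖ H) * ρ) = (G ⊗ₖ H) * link τ F ρ := by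
  ext p q
  rw [Matrix.mul_apply]
  simp only [link, Matrix.of_apply, one_kronecker_mul_apply, Matrix.kroneckerMap_apply,
    Finset.mul_sum, Finset.sum_mul]
  conv_rhs => rw [Finset.sum_comm]
  refine Finset.sum_congr rfl fun k _ => ?_
  conv_rhs => rw [Finset.sum_comm]
  refine Finset.sum_congr rfl fun k' _ => ?_
  conv_rhs => rw [Fintype.sum_prod_type_right]
  refine Finset.sum_congr rfl fun r _ => Finset.sum_congr rfl fun b _ => ?_
  ring

lemma link_kronecker_conj [DecidableEq X] [DecidableEq Y] (τ : Matrix (X × B) (X × B) ℂ)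
    (F : Matrix (X × Y) (X × Y) ℂ) (ρ : Matrix (Y × R) (Y × R) ℂ) {G : Matrix B B ℂ}
    {H : Matrix R R ℂ} (hG : G.IsHermitian) (hH : H.IsHermitian) :
    link ((1 ⊗ₖ G) * τ * (1 ⊗ₖ G)) F ((1 ⊗ₖ H) * ρ * (1 ⊗ₖ H)) =
      (G ⊗ₖ H) * link τ F ρ * (G ⊗ₖ H) := by
  have hr : ∀ (τ : Matrix (X × B) (X × B) ℂ) (ρ : Matrix (Y × R) (Y × R) ℂ),
      link (τ * (1 ⊗ₖ G)) F (ρ * (1 ⊗ₖ H)) = link τ F ρ * (G ⊗ₖ H) := by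
    intro τ ρ
    apply Matrix.conjTranspose_injective
    rw [conjTranspose_link, Matrix.conjTranspose_mul, Matrix.conjTranspose_mul,
      Matrix.conjTranspose_mul, conjTranspose_link, Matrix.conjTranspose_kronecker,
      Matrix.conjTranspose_kronecker, Matrix.conjTranspose_kronecker, hG.eq, hH.eq,
      Matrix.conjTranspose_one, Matrix.conjTranspose_one, link_kronecker_mul]
  rw [hr, link_kronecker_mul]

end Link

section ProdKernel

variable {ι : Type*} [Fintype ι] {A : ι → Type*}

/-- The tensor product of a family of operators on `A i A i`, as an operator on the product of
two copies of `∀ i, A i`. -/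
def prodKernel (f : ∀ i, Matrix (A i × A i) (A i × A i) ℂ) :
    Matrix ((∀ i, A i) × (∀ i, A i)) ((∀ i, A i) × (∀ i, A i)) ℂ :=
  Matrix.of fun p q => ∏ i, f i (p.1 i, p.2 i) (q.1 i, q.2 i)

lemma prodKernel_apply (f : ∀ i, Matrix (A i × A i) (A i × A i) ℂ)
    (p q : (∀ i, A i) × (∀ i, A i)) :
    prodKernel f p q = ∏ i, f i (p.1 i, p.2 i) (q.1 i, q.2 i) := rfl

lemma conjTranspose_prodKernel (f : ∀ i, Matrix (A i × A i) (A i × A i) ℂ) :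
    (prodKernel f)ᴴ = prodKernel fun i => (f i)ᴴ := by
  ext p q
  simp [prodKernel]

variable [DecidableEq ι]

lemma prodKernel_mul [∀ i, Fintype (A i)] (f g : ∀ i, Matrix (A i × A i) (A i × A i) ℂ) :
    (prodKernel f * prodKernel g : Matrix _ _ ℂ) = prodKernel fun i => f i * g i := by
  ext p q
  simp only [Matrix.mul_apply, prodKernel, Matrix.of_apply, Fintype.sum_prod_type,
    ← Finset.prod_mul_distrib, Finset.prod_univ_sum, Fintype.piFinset_univ]

lemma prodKernel_one [∀ i, DecidableEq (A i)] :
    prodKernel (fun i => (1 : Matrix (A i × A i) (A i × A i) ℂ)) = 1 := by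
  ext p q
  simp only [prodKernel_apply, Matrix.one_apply, Finset.prod_ite_zero, Finset.prod_const_one]
  refine if_congr ?_ rfl rfl
  simp [Prod.ext_iff, funext_iff, forall_and]

omit [DecidableEq ι] in
lemma prodKernel_smul (c : ι → ℂ) (f : ∀ i, Matrix (A i × A i) (A i × A i) ℂ) :
    prodKernel (fun i => c i • f i) = (∏ i, c i) • prodKernel f := by
  ext p q
  simp [prodKernel, Finset.prod_mul_distrib]

lemma prodKernel_add (f g : ∀ i, Matrix (A i × A i) (A i × A i) ℂ) :
    prodKernel (fun i => f i + g i) =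
      ∑ s : Finset ι, prodKernel fun i => if i ∈ s then f i else g i := by
  ext p q
  rw [Matrix.sum_apply]
  simp only [prodKernel_apply, Matrix.add_apply]
  rw [Finset.prod_add, Finset.powerset_univ]
  refine Finset.sum_congr rfl fun s _ => ?_
  rw [← Finset.prod_mul_prod_compl s (fun i => (if i ∈ s then f i else g i) _ _),
    Finset.compl_eq_univ_sdiff]
  congr 1
  · exact Finset.prod_congr rfl fun i hi => by rw [if_pos hi]
  · exact Finset.prod_congr rfl fun i hi => by rw [if_neg (Finset.mem_sdiff.1 hi).2]

lemma posSemidef_prodKernel [∀ i, Fintype (A i)]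
    {f : ∀ i, Matrix (A i × A i) (A i × A i) ℂ} (hf : ∀ i, (f i).PosSemidef) :
    (prodKernel f).PosSemidef := by
  classical
  have : ∀ i, ∃ V : Matrix (A i × A i) (A i × A i) ℂ, f i = Vᴴ * V := fun i => by
    open scoped MatrixOrder in
    simpa [Matrix.star_eq_conjTranspose] using
      CStarAlgebra.nonneg_iff_eq_star_mul_self.mp (hf i).nonneg
  choose V hV using this
  rw [show f = fun i => (V i)ᴴ * V i from funext hV, ← prodKernel_mul,
    ← conjTranspose_prodKernel]
  exact Matrix.posSemidef_conjTranspose_mul_self _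

/-- Splitting of a tensor product of differences of positive operators. -/
lemma exists_prodKernel_sub [∀ i, Fintype (A i)]
    {f g : ∀ i, Matrix (A i × A i) (A i × A i) ℂ}
    (hf : ∀ i, (f i).PosSemidef) (hg : ∀ i, (g i).PosSemidef) :
    ∃ P N : Matrix ((∀ i, A i) × (∀ i, A i)) ((∀ i, A i) × (∀ i, A i)) ℂ,
      P.PosSemidef ∧ N.PosSemidef ∧ prodKernel (fun i => f i - g i) = P - N ∧
      prodKernel (fun i => f i + g i) = P + N := by
  let K : Finset ι → Matrix ((∀ i, A i) × (∀ i, A i)) ((∀ i, A i) × (∀ i, A i)) ℂ :=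
    fun s => prodKernel fun i => if i ∈ s then f i else g i
  have hK : ∀ s, (K s).PosSemidef := fun s => posSemidef_prodKernel fun i => by
    by_cases h : i ∈ s <;> simp [h, hf, hg]
  have hsub : prodKernel (fun i => f i - g i) = ∑ s : Finset ι, (-1 : ℂ) ^ sᶜ.card • K s := by
    have : (fun i => f i - g i) = fun i => f i + (-1 : ℂ) • g i := by
      ext i : 1; simp [sub_eq_add_neg]
    rw [this, prodKernel_add]
    refine Finset.sum_congr rfl fun s _ => ?_
    have h2 : (fun i => if i ∈ s then f i else (-1 : ℂ) • g i) =
        fun i => (if i ∈ s then 1 else -1 : ℂ) • (if i ∈ s then f i else g i) := by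
      ext i : 1; split_ifs <;> simp
    rw [h2, prodKernel_smul, Finset.prod_ite]
    simp [K, ← Finset.compl_filter]
  refine ⟨∑ s : Finset ι with Even sᶜ.card, K s, ∑ s : Finset ι with ¬ Even sᶜ.card, K s,
    Matrix.posSemidef_sum _ fun s _ => hK s, Matrix.posSemidef_sum _ fun s _ => hK s, ?_, ?_⟩
  · rw [hsub, ← Finset.sum_filter_add_sum_filter_not _ fun s : Finset ι => Even sᶜ.card,
      sub_eq_add_neg, ← Finset.sum_neg_distrib]
    congr 1
    · exact Finset.sum_congr rfl fun s hs => by simp [(Finset.mem_filter.1 hs).2.neg_one_pow]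
    · exact Finset.sum_congr rfl fun s hs => by
        simp [(Nat.not_even_iff_odd.1 (Finset.mem_filter.1 hs).2).neg_one_pow]
  · rw [prodKernel_add, Finset.sum_filter_add_sum_filter_not]

end ProdKernel

section SecondMoment

variable {Ω X Y B R : Type*} [Fintype X] [Fintype Y] [MeasurableSpace Ω] {μ : Measure Ω}

lemma exists_real_quadForm [DecidableEq X] {Q : Matrix X X ℂ} (hQ : Q.IsHermitian)
    (hQ2 : Q * Q = Q) (t : X → ℂ) :
    ∃ r : ℝ, ∑ a, ∑ c, t a * star (t c) * Q a c = r ∧ 0 ≤ r ∧ r ≤ ∑ a, ‖t a‖ ^ 2 := by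
  have hpos : ∀ {P : Matrix X X ℂ}, P.IsHermitian → P * P = P → P.PosSemidef := by
    intro P hP hP2
    have := Matrix.posSemidef_conjTranspose_mul_self P
    rwa [hP.eq, hP2] at this
  have h1 := (hpos hQ hQ2).dotProduct_mulVec_nonneg (star t)
  have h2 := (hpos (Matrix.isHermitian_one.sub hQ) (by
    rw [sub_mul, mul_sub, mul_sub, hQ2]; simp)).dotProduct_mulVec_nonneg (star t)
  have hs : ∑ a, ∑ c, t a * star (t c) * Q a c = star (star t) ⬝ᵥ Q.mulVec (star t) := by
    simp only [dotProduct, Matrix.mulVec, star_star, Finset.mul_sum, Pi.star_apply]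
    exact Finset.sum_congr rfl fun a _ => Finset.sum_congr rfl fun c _ => by ring
  have hn : star (star t) ⬝ᵥ star t = ((∑ a, ‖t a‖ ^ 2 : ℝ) : ℂ) := by
    simp [dotProduct, Complex.mul_conj, Complex.normSq_eq_norm_sq]
  rw [Matrix.sub_mulVec, dotProduct_sub, Matrix.one_mulVec, hn, ← hs] at h2
  rw [← hs] at h1
  generalize (∑ a, ∑ c, t a * star (t c) * Q a c) = z at *
  rw [Complex.le_def] at h1 h2
  simp only [Complex.sub_re, Complex.ofReal_re, Complex.zero_re, Complex.zero_im] at h1 h2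
  exact ⟨z.re, Complex.ext rfl (by simpa using h1.2.symm), h1.1, by linarith⟩

/-- Second moment of a bilinear form in a random matrix with factorising covariance. -/
lemma integral_norm_sq_le [DecidableEq X] [DecidableEq Y]
    {F : Ω → Matrix (X × Y) (X × Y) ℂ} {c : ℝ} (hc : 0 ≤ c)
    {Q : Matrix (X × X) (X × X) ℂ} {Q' : Matrix (Y × Y) (Y × Y) ℂ}
    (hQ : Q.IsHermitian) (hQ2 : Q * Q = Q) (hQ' : Q'.IsHermitian) (hQ2' : Q' * Q' = Q')
    (hint : ∀ k k' l l', Integrable (fun ω => F ω k k' * star (F ω l l')) μ)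
    (hcov : ∀ k k' l l', ∫ ω, F ω k k' * star (F ω l l') ∂μ =
      c * (Q (k.1, k'.1) (l.1, l'.1) * Q' (k.2, k'.2) (l.2, l'.2)))
    (t : X × X → ℂ) (x : Y × Y → ℂ) :
    ∫ ω, ‖∑ k : X × Y, ∑ k' : X × Y, t (k.1, k'.1) * F ω k k' * x (k.2, k'.2)‖ ^ 2 ∂μ ≤
      c * ((∑ a, ‖t a‖ ^ 2) * ∑ b, ‖x b‖ ^ 2) := by
  obtain ⟨r, hr, hr0, hr1⟩ := exists_real_quadForm hQ hQ2 t
  obtain ⟨r', hr', hr0', hr1'⟩ := exists_real_quadForm hQ' hQ2' x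
  let w : (X × Y) × (X × Y) → ℂ := fun j => t (j.1.1, j.2.1) * x (j.1.2, j.2.2)
  have hexp : ∀ ω, ((‖∑ k : X × Y, ∑ k' : X × Y,
      t (k.1, k'.1) * F ω k k' * x (k.2, k'.2)‖ ^ 2 : ℝ) : ℂ) =
      ∑ j, ∑ l, w j * star (w l) * (F ω j.1 j.2 * star (F ω l.1 l.2)) := by
    intro ω
    have : ∑ k : X × Y, ∑ k' : X × Y, t (k.1, k'.1) * F ω k k' * x (k.2, k'.2) =
        ∑ j : (X × Y) × (X × Y), w j * F ω j.1 j.2 := by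
      conv_rhs => rw [Fintype.sum_prod_type]
      exact Finset.sum_congr rfl fun k _ => Finset.sum_congr rfl fun k' _ => by
        simp only [w]; ring
    rw [this, ← Complex.normSq_eq_norm_sq, ← Complex.mul_conj, ← RCLike.star_def, star_sum,
      Finset.sum_mul_sum]
    refine Finset.sum_congr rfl fun j _ => Finset.sum_congr rfl fun l _ => ?_
    rw [star_mul']; ring
  have hval : ((∫ ω, ‖∑ k : X × Y, ∑ k' : X × Y,
      t (k.1, k'.1) * F ω k k' * x (k.2, k'.2)‖ ^ 2 ∂μ : ℝ) : ℂ) = ((c * (r * r') : ℝ) : ℂ) := by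
    rw [← integral_complex_ofReal]
    simp only [hexp]
    rw [integral_finsetSum _ fun j _ => integrable_finsetSum _ fun l _ =>
      (hint _ _ _ _).const_mul _]
    have : ∀ j : (X × Y) × (X × Y),
        ∫ ω, ∑ l, w j * star (w l) * (F ω j.1 j.2 * star (F ω l.1 l.2)) ∂μ =
        ∑ l, w j * star (w l) *
          (c * (Q (j.1.1, j.2.1) (l.1.1, l.2.1) * Q' (j.1.2, j.2.2) (l.1.2, l.2.2))) := by
      intro j
      rw [integral_finsetSum _ fun l _ => (hint _ _ _ _).const_mul _]
      exact Finset.sum_congr rfl fun l _ => by rw [integral_const_mul, hcov]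
    simp only [this]
    push_cast
    rw [← hr, ← hr']
    let e := Equiv.prodProdProdComm X X Y Y
    rw [← e.sum_comp]
    have : ∀ p : (X × X) × (Y × Y),
        ∑ l, w (e p) * star (w l) * (c * (Q ((e p).1.1, (e p).2.1) (l.1.1, l.2.1) *
          Q' ((e p).1.2, (e p).2.2) (l.1.2, l.2.2))) =
        ∑ l : (X × X) × (Y × Y), c * ((t p.1 * star (t l.1) * Q p.1 l.1) *
          (x p.2 * star (x l.2) * Q' p.2 l.2)) := by
      intro p
      rw [← e.sum_comp]
      refine Finset.sum_congr rfl fun l _ => ?_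
      simp only [w, e, Equiv.prodProdProdComm_apply, star_mul']
      ring
    simp only [this, Fintype.sum_prod_type (f := fun z : (X × X) × (Y × Y) => _),
      ← Finset.mul_sum, ← Finset.sum_mul]
  rw [Complex.ofReal_inj.1 hval]
  gcongr

lemma sum_pairs_comm [Fintype B] (f : X × B → X × B → ℝ) :
    ∑ i, ∑ j, f i j = ∑ b : B, ∑ b' : B, ∑ a : X × X, f (a.1, b) (a.2, b') := by
  simp only [Fintype.sum_prod_type]
  rw [Finset.sum_comm]
  refine Finset.sum_congr rfl fun b _ => ?_
  conv_rhs => rw [Finset.sum_comm]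
  exact Finset.sum_congr rfl fun a _ => Finset.sum_comm

lemma integral_frobNorm_link_sq_le [DecidableEq X] [DecidableEq Y] [Fintype B] [Fintype R]
    {F : Ω → Matrix (X × Y) (X × Y) ℂ} {c : ℝ} (hc : 0 ≤ c)
    {Q : Matrix (X × X) (X × X) ℂ} {Q' : Matrix (Y × Y) (Y × Y) ℂ}
    (hQ : Q.IsHermitian) (hQ2 : Q * Q = Q) (hQ' : Q'.IsHermitian) (hQ2' : Q' * Q' = Q')
    (hint : ∀ k k' l l', Integrable (fun ω => F ω k k' * star (F ω l l')) μ)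
    (hcov : ∀ k k' l l', ∫ ω, F ω k k' * star (F ω l l') ∂μ =
      c * (Q (k.1, k'.1) (l.1, l'.1) * Q' (k.2, k'.2) (l.2, l'.2)))
    (τ : Matrix (X × B) (X × B) ℂ) (ρ : Matrix (Y × R) (Y × R) ℂ)
    (hint2 : ∀ p q, Integrable (fun ω => ‖link τ (F ω) ρ p q‖ ^ 2) μ) :
    ∫ ω, frobNorm (link τ (F ω) ρ) ^ 2 ∂μ ≤ c * (frobNorm τ ^ 2 * frobNorm ρ ^ 2) := by
  simp only [frobNorm_sq]
  rw [integral_finsetSum _ fun p _ => integrable_finsetSum _ fun q _ => hint2 p q]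
  simp only [integral_finsetSum _ fun q _ => hint2 _ q]
  calc ∑ p, ∑ q, ∫ ω, ‖link τ (F ω) ρ p q‖ ^ 2 ∂μ
      ≤ ∑ p : B × R, ∑ q : B × R, c * ((∑ a : X × X, ‖τ (a.1, p.1) (a.2, q.1)‖ ^ 2) *
          ∑ b : Y × Y, ‖ρ (b.1, p.2) (b.2, q.2)‖ ^ 2) :=
        Finset.sum_le_sum fun p _ => Finset.sum_le_sum fun q _ =>
          integral_norm_sq_le hc hQ hQ2 hQ' hQ2' hint hcov
            (fun a => τ (a.1, p.1) (a.2, q.1)) (fun b => ρ (b.1, p.2) (b.2, q.2))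
    _ = _ := by
        rw [sum_pairs_comm fun i j => ‖τ i j‖ ^ 2, sum_pairs_comm fun i j => ‖ρ i j‖ ^ 2]
        simp only [Fintype.sum_prod_type (f := fun z : B × R => _), ← Finset.mul_sum,
          ← Finset.sum_mul]

end SecondMoment

section PiHaar

variable {ι : Type*} [Fintype ι] {A : ι → Type*} [∀ i, Fintype (A i)] [∀ i, DecidableEq (A i)]

/-- The product of the Haar probability measures. -/
abbrev piHaar (A : ι → Type*) [∀ i, Fintype (A i)] [∀ i, DecidableEq (A i)] :
    Measure (∀ i, Matrix.unitaryGroup (A i) ℂ) :=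
  Measure.pi fun i => haarUnitary (A i)

lemma integrable_piHaar_of_continuous {E : Type*} [NormedAddCommGroup E]
    [SecondCountableTopology E] {f : (∀ i, Matrix.unitaryGroup (A i) ℂ) → E}
    (hf : Continuous f) : Integrable f (piHaar A) :=
  hf.integrable_of_hasCompactSupport (HasCompactSupport.of_compactSpace f)

variable [DecidableEq ι]

lemma integral_prod_subtype (S : Finset ι)
    (g : ∀ i : {i // i ∈ S}, Matrix.unitaryGroup (A i) ℂ → ℂ) :
    ∫ U, ∏ i : {i // i ∈ S}, g i (U i) ∂piHaar A =
      ∏ i : {i // i ∈ S}, ∫ u, g i u ∂haarUnitary (A i) := by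
  let h : ∀ i, Matrix.unitaryGroup (A i) ℂ → ℂ :=
    fun i u => if hi : i ∈ S then g ⟨i, hi⟩ u else 1
  have key : ∀ w : ι → ℂ, (∀ i ∉ S, w i = 1) → ∏ i, w i = ∏ i : {i // i ∈ S}, w i := by
    intro w hw
    rw [← Finset.prod_subset (Finset.subset_univ S) fun i _ hi => hw i hi]
    exact (Finset.prod_coe_sort S w).symm
  have h1 : ∀ U : (∀ i, Matrix.unitaryGroup (A i) ℂ),
      ∏ i : {i // i ∈ S}, g i (U i) = ∏ i, h i (U i) := by
    intro U
    rw [key _ fun i hi => by simp [h, hi]]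
    exact Finset.prod_congr rfl fun i _ => by simp [h]
  simp only [h1]
  rw [integral_fintype_prod_eq_prod, key _ fun i hi => by simp [h, hi]]
  exact Finset.prod_congr rfl fun i _ => by simp [h]

/-- The Choi matrix of conjugation by `U`. -/
def unitKernel {X : Type*} (U : Matrix X X ℂ) : Matrix (X × X) (X × X) ℂ :=
  Matrix.of fun p q => U p.1 p.2 * star (U q.1 q.2)

lemma posSemidef_unitKernel {X : Type*} [Fintype X] (U : Matrix X X ℂ) :
    (unitKernel U).PosSemidef :=
  Matrix.posSemidef_vecMulVec_self_star fun p : X × X => U p.1 p.2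

lemma centredKernel_eq {X : Type*} [Fintype X] [DecidableEq X] (U : Matrix X X ℂ) :
    centredKernel U = unitKernel U - (Fintype.card X : ℂ)⁻¹ • 1 := rfl

/-- The tensor product of the centred kernels of the unitaries in `S`. -/
def centredProd (S : Finset ι) (U : ∀ i, Matrix.unitaryGroup (A i) ℂ) :
    Matrix ((∀ i : {i // i ∈ S}, A i) × (∀ i : {i // i ∈ S}, A i))
      ((∀ i : {i // i ∈ S}, A i) × (∀ i : {i // i ∈ S}, A i)) ℂ :=
  prodKernel fun i : {i // i ∈ S} => centredKernel (U i).1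

/-- The tensor product of the sums of the kernels of the unitaries in `S` and their means. -/
def absProd (S : Finset ι) (U : ∀ i, Matrix.unitaryGroup (A i) ℂ) :
    Matrix ((∀ i : {i // i ∈ S}, A i) × (∀ i : {i // i ∈ S}, A i))
      ((∀ i : {i // i ∈ S}, A i) × (∀ i : {i // i ∈ S}, A i)) ℂ :=
  prodKernel fun i : {i // i ∈ S} => unitKernel (U i).1 + (Fintype.card (A i) : ℂ)⁻¹ • 1

omit [Fintype ι] in
lemma exists_centredProd_eq (S : Finset ι) (U : ∀ i, Matrix.unitaryGroup (A i) ℂ) :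
    ∃ P N, P.PosSemidef ∧ N.PosSemidef ∧ centredProd S U = P - N ∧ absProd S U = P + N :=
  exists_prodKernel_sub (fun i => posSemidef_unitKernel _)
    (fun i => Matrix.PosSemidef.one.smul (by positivity))

omit [Fintype ι] [DecidableEq ι] in
lemma continuous_centredProd_apply (S : Finset ι)
    (k k' : (∀ i : {i // i ∈ S}, A i) × (∀ i : {i // i ∈ S}, A i)) :
    Continuous fun U : (∀ i, Matrix.unitaryGroup (A i) ℂ) => centredProd S U k k' := by
  simp only [centredProd, prodKernel_apply, centredKernel, Matrix.sub_apply, Matrix.of_apply]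
  have h : ∀ i a b, Continuous fun U : (∀ i, Matrix.unitaryGroup (A i) ℂ) => (U i).1 a b :=
    fun i a b => (continuous_unitary_apply a b).comp (continuous_apply i)
  exact continuous_finsetProd _ fun i _ => (((h _ _ _).mul (h _ _ _).star).sub continuous_const)

omit [Fintype ι] [DecidableEq ι] in
lemma continuous_absProd_apply (S : Finset ι)
    (k k' : (∀ i : {i // i ∈ S}, A i) × (∀ i : {i // i ∈ S}, A i)) :
    Continuous fun U : (∀ i, Matrix.unitaryGroup (A i) ℂ) => absProd S U k k' := by
  simp only [absProd, prodKernel_apply, unitKernel, Matrix.add_apply, Matrix.of_apply]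
  have h : ∀ i a b, Continuous fun U : (∀ i, Matrix.unitaryGroup (A i) ℂ) => (U i).1 a b :=
    fun i a b => (continuous_unitary_apply a b).comp (continuous_apply i)
  exact continuous_finsetProd _ fun i _ => (((h _ _ _).mul (h _ _ _).star).add continuous_const)

lemma integral_absProd (S : Finset ι)
    (k k' : (∀ i : {i // i ∈ S}, A i) × (∀ i : {i // i ∈ S}, A i)) :
    ∫ U, absProd S U k k' ∂piHaar A =
      ((∏ i : {i // i ∈ S}, 2 * (Fintype.card (A i) : ℂ)⁻¹) • (1 : Matrix _ _ ℂ)) k k' := by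
  rw [← prodKernel_one, ← prodKernel_smul, prodKernel_apply]
  simp only [absProd, prodKernel_apply]
  rw [integral_prod_subtype S fun i u => (unitKernel u.1 + (Fintype.card (A i) : ℂ)⁻¹ • 1)
    (k.1 i, k.2 i) (k'.1 i, k'.2 i)]
  refine Finset.prod_congr rfl fun i _ => ?_
  simp only [Matrix.add_apply]
  rw [integral_add (integrable_of_continuous (by simp only [unitKernel, Matrix.of_apply]; fun_prop))
    (integrable_const _)]
  have := moment₂_eq (k.2 i) (k'.2 i) (k.1 i) (k'.1 i)
  rw [moment₂] at this
  simp only [unitKernel, Matrix.of_apply, this]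
  simp only [Matrix.smul_apply, Matrix.one_apply, Prod.mk.injEq, integral_const, probReal_univ,
    one_smul, smul_eq_mul]
  split_ifs
  · ring
  · ring

lemma integral_centredProd (S : Finset ι) (hA : ∀ i, 2 ≤ Fintype.card (A i))
    (k k' l l' : (∀ i : {i // i ∈ S}, A i) × (∀ i : {i // i ∈ S}, A i)) :
    ∫ U, centredProd S U k k' * star (centredProd S U l l') ∂piHaar A =
      ((∏ i : {i // i ∈ S}, ((Fintype.card (A i) : ℝ) ^ 2 - 1)⁻¹ : ℝ) : ℂ) *
        (prodKernel (fun i : {i // i ∈ S} => 1 - epr (A i)) (k.1, k'.1) (l.1, l'.1) *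
        prodKernel (fun i : {i // i ∈ S} => 1 - epr (A i)) (k.2, k'.2) (l.2, l'.2)) := by
  simp only [centredProd, prodKernel_apply, star_prod, ← Finset.prod_mul_distrib]
  rw [integral_prod_subtype S fun i u => centredKernel u.1 (k.1 i, k.2 i) (k'.1 i, k'.2 i) *
    star (centredKernel u.1 (l.1 i, l.2 i) (l'.1 i, l'.2 i))]
  push_cast
  rw [← Finset.prod_mul_distrib]
  exact Finset.prod_congr rfl fun i _ => integral_centredKernel (hA i) _ _ _ _ _ _ _ _

lemma isHermitian_epr (X : Type*) [Fintype X] [DecidableEq X] : (epr X).IsHermitian := by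
  ext p q
  simp only [epr, Matrix.conjTranspose_apply, Matrix.of_apply, and_comm]
  split_ifs <;> simp

lemma epr_mul_epr (X : Type*) [Fintype X] [DecidableEq X] : epr X * epr X = epr X := by
  ext p q
  have hd : p.1 = p.2 → (Fintype.card X : ℂ) ≠ 0 := fun _ => by
    have : Nonempty X := ⟨p.1⟩
    exact_mod_cast Fintype.card_ne_zero
  simp only [epr, Matrix.mul_apply, Matrix.of_apply, Fintype.sum_prod_type]
  by_cases h1 : p.1 = p.2 <;> by_cases h2 : q.1 = q.2 <;> simp [h1, h2]
  simp [hd h1]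

omit [Fintype ι] [DecidableEq ι] in
lemma isHermitian_prodKernel_one_sub_epr (S : Finset ι) :
    (prodKernel fun i : {i // i ∈ S} => 1 - epr (A i)).IsHermitian := by
  rw [Matrix.IsHermitian, conjTranspose_prodKernel]
  congr 1; ext i : 1
  exact (Matrix.isHermitian_one.sub (isHermitian_epr _)).eq

omit [Fintype ι] in
lemma prodKernel_one_sub_epr_mul_self (S : Finset ι) :
    (prodKernel fun i : {i // i ∈ S} => 1 - epr (A i)) *
      (prodKernel fun i : {i // i ∈ S} => 1 - epr (A i)) =
      prodKernel fun i : {i // i ∈ S} => 1 - epr (A i) := by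
  rw [prodKernel_mul]
  congr 1; ext i : 1
  rw [sub_mul, mul_sub, mul_sub, epr_mul_epr]; simp

end PiHaar

section TermBound

lemma schattenNorm_one_smul_le {X : Type*} [Fintype X] [DecidableEq X] {M : Matrix X X ℂ}
    (hM : M.IsHermitian) {c : ℝ} (hc : 0 ≤ c) :
    schattenNorm 1 ((c : ℂ) • M) ≤ c * schattenNorm 1 M := by
  obtain ⟨P, N, hP, hN, h, h'⟩ := exists_posSemidef_sub hM
  have hc' : (0 : ℂ) ≤ c := by exact_mod_cast hc
  have := schattenNorm_one_sub_le (hP.smul hc') (hN.smul hc')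
  rw [h', h, smul_sub]
  simpa [mul_add, Matrix.trace_smul] using this

lemma integral_le_sqrt {Ω : Type*} [MeasurableSpace Ω] {μ : Measure Ω} [IsProbabilityMeasure μ]
    {f : Ω → ℝ} (hf : Integrable f μ) (hf2 : Integrable (fun ω => f ω ^ 2) μ) :
    ∫ ω, f ω ∂μ ≤ √(∫ ω, f ω ^ 2 ∂μ) := by
  apply Real.le_sqrt_of_sq_le
  set m := ∫ ω, f ω ∂μ with hm
  have h0 : 0 ≤ ∫ ω, (f ω - m) ^ 2 ∂μ := integral_nonneg fun ω => sq_nonneg _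
  have h1 : ∀ ω, (f ω - m) ^ 2 = f ω ^ 2 - (2 * m * f ω - m ^ 2) := fun ω => by ring
  simp only [h1] at h0
  have h2 : Integrable (fun ω => 2 * m * f ω - m ^ 2) μ :=
    (hf.const_mul _).sub (integrable_const _)
  rw [integral_sub hf2 h2, integral_sub (hf.const_mul _) (integrable_const _), integral_const_mul, ← hm] at h0
  simp at h0
  nlinarith

lemma mul_inv_sq_sub_one_rpow {c : ℝ} (hc : 2 ≤ c) :
    c * ((c ^ 2 - 1)⁻¹) ^ (1 / 2 : ℝ) = (1 - (c ^ 2)⁻¹) ^ (-1 / 2 : ℝ) := by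
  have h3 : 0 < c ^ 2 - 1 := by nlinarith
  have h4 : 1 - (c ^ 2)⁻¹ = (c ^ 2 * (c ^ 2 - 1)⁻¹)⁻¹ := by field_simp
  rw [h4, neg_div, Real.rpow_neg (by positivity), ← Real.inv_rpow (by positivity) (1 / 2), inv_inv,
    Real.mul_rpow (by positivity) (by positivity), ← Real.sqrt_eq_rpow, ← Real.sqrt_eq_rpow,
    Real.sqrt_sq (by positivity)]

variable {ι : Type*} [Fintype ι] [DecidableEq ι] {A : ι → Type*} [∀ i, Fintype (A i)]
  [∀ i, DecidableEq (A i)] {B R : Type*}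

omit [Fintype ι] [DecidableEq ι] in
lemma isHermitian_centredProd (S : Finset ι) (U : ∀ i, Matrix.unitaryGroup (A i) ℂ) :
    (centredProd S U).IsHermitian := by
  classical
  obtain ⟨P, N, hP, hN, h, -⟩ := exists_centredProd_eq S U
  rw [h]; exact hP.isHermitian.sub hN.isHermitian

lemma isHermitian_link {X Y : Type*} [Fintype X] [Fintype Y] {τ : Matrix (X × B) (X × B) ℂ}
    {F : Matrix (X × Y) (X × Y) ℂ} {ρ : Matrix (Y × R) (Y × R) ℂ} (hτ : τ.IsHermitian)
    (hF : F.IsHermitian) (hρ : ρ.IsHermitian) : (link τ F ρ).IsHermitian := by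
  rw [Matrix.IsHermitian, conjTranspose_link, hτ.eq, hF.eq, hρ.eq]

variable [Fintype B] [Fintype R]

omit [Fintype ι] in
lemma continuous_trace_link_absProd (S : Finset ι)
    (τ : Matrix ((∀ i : {i // i ∈ S}, A i) × B) ((∀ i : {i // i ∈ S}, A i) × B) ℂ)
    (ρ : Matrix ((∀ i : {i // i ∈ S}, A i) × R) ((∀ i : {i // i ∈ S}, A i) × R) ℂ) :
    Continuous fun U : (∀ i, Matrix.unitaryGroup (A i) ℂ) => (link τ (absProd S U) ρ).trace := by
  simp only [trace_link]
  exact continuous_finsetSum _ fun k _ => continuous_finsetSum _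
    fun k' _ => continuous_const.mul (continuous_absProd_apply S k k')

lemma integral_trace_link_absProd (S : Finset ι)
    {τ : Matrix ((∀ i : {i // i ∈ S}, A i) × B) ((∀ i : {i // i ∈ S}, A i) × B) ℂ}
    {ρ : Matrix ((∀ i : {i // i ∈ S}, A i) × R) ((∀ i : {i // i ∈ S}, A i) × R) ℂ}
    (hτ : τ.PosSemidef) :
    ∫ U, (link τ (absProd S U) ρ).trace.re ∂piHaar A =
      (∏ i : {i // i ∈ S}, 2 * (Fintype.card (A i) : ℝ)⁻¹) * (τ.trace.re * ρ.trace.re) := by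
  have hi : ∀ (c : ℂ) (k k' : (∀ i : {i // i ∈ S}, A i) × (∀ i : {i // i ∈ S}, A i)),
      Integrable (fun U => c * absProd S U k k') (piHaar A) := fun c k k' =>
    integrable_piHaar_of_continuous (continuous_const.mul (continuous_absProd_apply S k k'))
  have hc : ∫ U, (link τ (absProd S U) ρ).trace ∂piHaar A =
      (link τ ((∏ i : {i // i ∈ S}, 2 * (Fintype.card (A i) : ℂ)⁻¹) • 1) ρ).trace := by
    simp only [trace_link]
    rw [integral_finsetSum _ fun k _ => integrable_finsetSum _ fun k' _ => hi _ k k']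
    refine Finset.sum_congr rfl fun k _ => ?_
    rw [integral_finsetSum _ fun k' _ => hi _ k k']
    refine Finset.sum_congr rfl fun k' _ => ?_
    rw [integral_const_mul, integral_absProd]
  have hre : ∫ U, (link τ (absProd S U) ρ).trace.re ∂piHaar A =
      (∫ U, (link τ (absProd S U) ρ).trace ∂piHaar A).re :=
    Complex.reCLM.integral_comp_comm
      (integrable_piHaar_of_continuous (continuous_trace_link_absProd S τ ρ))
  have hτ' : τ.trace = (τ.trace.re : ℂ) :=
    Complex.ext rfl (by simpa using (Complex.le_def.1 hτ.trace_nonneg).2.symm)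
  have hs : (∏ i : {i // i ∈ S}, 2 * (Fintype.card (A i) : ℂ)⁻¹) =
      ((∏ i : {i // i ∈ S}, 2 * (Fintype.card (A i) : ℝ)⁻¹ : ℝ) : ℂ) := by push_cast; rfl
  rw [hre, hc, trace_link_one, hs, hτ', Complex.re_ofReal_mul, Complex.re_ofReal_mul]
  simp

omit [Fintype ι] [Fintype B] [Fintype R] in
lemma continuous_link_centredProd (S : Finset ι)
    (τ : Matrix ((∀ i : {i // i ∈ S}, A i) × B) ((∀ i : {i // i ∈ S}, A i) × B) ℂ)
    (ρ : Matrix ((∀ i : {i // i ∈ S}, A i) × R) ((∀ i : {i // i ∈ S}, A i) × R) ℂ) (p q : B × R) :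
    Continuous fun U : (∀ i, Matrix.unitaryGroup (A i) ℂ) => link τ (centredProd S U) ρ p q := by
  simp only [link, Matrix.of_apply]
  exact continuous_finsetSum _ fun k _ => continuous_finsetSum _ fun k' _ =>
    (continuous_const.mul (continuous_centredProd_apply S k k')).mul continuous_const

omit [Fintype ι] in
lemma continuous_frobNorm_link (S : Finset ι)
    (τ : Matrix ((∀ i : {i // i ∈ S}, A i) × B) ((∀ i : {i // i ∈ S}, A i) × B) ℂ)
    (ρ : Matrix ((∀ i : {i // i ∈ S}, A i) × R) ((∀ i : {i // i ∈ S}, A i) × R) ℂ) :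
    Continuous fun U : (∀ i, Matrix.unitaryGroup (A i) ℂ) =>
      frobNorm (link τ (centredProd S U) ρ) :=
  Real.continuous_sqrt.comp (continuous_finsetSum _ fun p _ => continuous_finsetSum _ fun q _ =>
    (continuous_link_centredProd S τ ρ p q).norm.pow 2)

lemma integral_frobNorm_link_le (S : Finset ι) (hA : ∀ i, 2 ≤ Fintype.card (A i))
    (τ : Matrix ((∀ i : {i // i ∈ S}, A i) × B) ((∀ i : {i // i ∈ S}, A i) × B) ℂ)
    (ρ : Matrix ((∀ i : {i // i ∈ S}, A i) × R) ((∀ i : {i // i ∈ S}, A i) × R) ℂ) :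
    ∫ U, frobNorm (link τ (centredProd S U) ρ) ∂piHaar A ≤
      √(∏ i : {i // i ∈ S}, ((Fintype.card (A i) : ℝ) ^ 2 - 1)⁻¹) *
        (frobNorm τ * frobNorm ρ) := by
  have hc : 0 ≤ ∏ i : {i // i ∈ S}, ((Fintype.card (A i) : ℝ) ^ 2 - 1)⁻¹ := by
    refine Finset.prod_nonneg fun i _ => inv_nonneg.2 ?_
    have : (2 : ℝ) ≤ Fintype.card (A i) := by exact_mod_cast hA i
    nlinarith
  have hcont := continuous_frobNorm_link S τ ρ
  refine (integral_le_sqrt (integrable_piHaar_of_continuous hcont)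
    (integrable_piHaar_of_continuous (hcont.pow 2))).trans ?_
  refine (Real.sqrt_le_sqrt (integral_frobNorm_link_sq_le hc
    (isHermitian_prodKernel_one_sub_epr S) (prodKernel_one_sub_epr_mul_self S)
    (isHermitian_prodKernel_one_sub_epr S) (prodKernel_one_sub_epr_mul_self S)
    (fun k k' l l' => integrable_piHaar_of_continuous
      ((continuous_centredProd_apply S k k').mul (continuous_centredProd_apply S l l').star))
    (integral_centredProd S hA) τ ρ
    (fun p q => integrable_piHaar_of_continuous
      ((continuous_link_centredProd S τ ρ p q).norm.pow 2)))).trans_eq ?_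
  rw [Real.sqrt_mul hc, ← mul_pow,
    Real.sqrt_sq (mul_nonneg (frobNorm_nonneg _) (frobNorm_nonneg _))]

variable [DecidableEq B] [DecidableEq R]

omit [Fintype ι] in
lemma schattenNorm_one_link_centredProd_le (S : Finset ι)
    (U : ∀ i, Matrix.unitaryGroup (A i) ℂ)
    {τ₁ τ₂ : Matrix ((∀ i : {i // i ∈ S}, A i) × B) ((∀ i : {i // i ∈ S}, A i) × B) ℂ}
    {ρ₁ ρ₂ : Matrix ((∀ i : {i // i ∈ S}, A i) × R) ((∀ i : {i // i ∈ S}, A i) × R) ℂ}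
    (hτ₁ : τ₁.PosSemidef) (hτ₂ : τ₂.PosSemidef) (hρ₁ : ρ₁.PosSemidef) (hρ₂ : ρ₂.PosSemidef) :
    schattenNorm 1 (link (τ₁ - τ₂) (centredProd S U) (ρ₁ - ρ₂)) ≤
      (link (τ₁ + τ₂) (absProd S U) (ρ₁ + ρ₂)).trace.re := by
  obtain ⟨P, N, hP, hN, h, h'⟩ := exists_centredProd_eq S U
  rw [h, h']
  exact schattenNorm_one_link_le hτ₁ hτ₂ hP hN hρ₁ hρ₂

/-- `M` is of the form `(1 ⊗ G) N (1 ⊗ G)` with `Tr G⁴ ≤ 1` and `‖N‖₂ ≤ x`. -/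
def HasWeight {X Y : Type*} [Fintype X] [DecidableEq X] [Fintype Y]
    (M : Matrix (X × Y) (X × Y) ℂ) (x : ℝ) : Prop :=
  ∃ (G : Matrix Y Y ℂ) (N : Matrix (X × Y) (X × Y) ℂ), G.IsHermitian ∧ N.IsHermitian ∧
    (G * G * (G * G)).trace.re ≤ 1 ∧ frobNorm N ≤ x ∧ M = (1 ⊗ₖ G) * N * (1 ⊗ₖ G)

lemma schattenNorm_one_link_conj_le {X Y : Type*} [Fintype X] [Fintype Y] [DecidableEq X]
    [DecidableEq Y] {F : Matrix (X × Y) (X × Y) ℂ} (hF : F.IsHermitian)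
    {G : Matrix B B ℂ} {H : Matrix R R ℂ} {τ : Matrix (X × B) (X × B) ℂ}
    {ρ : Matrix (Y × R) (Y × R) ℂ} (hG : G.IsHermitian) (hH : H.IsHermitian)
    (hτ : τ.IsHermitian) (hρ : ρ.IsHermitian) (hG4 : (G * G * (G * G)).trace.re ≤ 1)
    (hH4 : (H * H * (H * H)).trace.re ≤ 1) :
    schattenNorm 1 (link ((1 ⊗ₖ G) * τ * (1 ⊗ₖ G)) F ((1 ⊗ₖ H) * ρ * (1 ⊗ₖ H))) ≤
      frobNorm (link τ F ρ) := by
  rw [link_kronecker_conj τ F ρ hG hH]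
  have hGH : (G ⊗ₖ H).IsHermitian := by
    rw [Matrix.IsHermitian, Matrix.conjTranspose_kronecker, hG.eq, hH.eq]
  refine (schattenNorm_one_conj_le hGH (isHermitian_link hτ hF hρ)).trans ?_
  have h1 : ((G ⊗ₖ H) * (G ⊗ₖ H) * ((G ⊗ₖ H) * (G ⊗ₖ H))).trace.re ≤ 1 := by
    simp only [← Matrix.mul_kronecker_mul, Matrix.trace_kronecker]
    have hg := Complex.le_def.1 (by
      have := (Matrix.posSemidef_conjTranspose_mul_self (G * G)).trace_nonneg
      rwa [Matrix.conjTranspose_mul, hG.eq] at this : (0 : ℂ) ≤ (G * G * (G * G)).trace)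
    have hh := Complex.le_def.1 (by
      have := (Matrix.posSemidef_conjTranspose_mul_self (H * H)).trace_nonneg
      rwa [Matrix.conjTranspose_mul, hH.eq] at this : (0 : ℂ) ≤ (H * H * (H * H)).trace)
    rw [Complex.mul_re, ← hg.2]
    simp only [Complex.zero_re, Complex.zero_im, zero_mul, sub_zero] at *
    exact mul_le_one₀ hG4 hh.1 hH4
  calc _ ≤ 1 * frobNorm (link τ F ρ) :=
        mul_le_mul_of_nonneg_right (Real.sqrt_le_one.2 h1) (frobNorm_nonneg _)
    _ = _ := one_mul _

/-- The contribution of a set `S` of systems, smoothed in both arguments. -/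
lemma exists_continuous_bound (S : Finset ι) (hA : ∀ i, 2 ≤ Fintype.card (A i))
    {τ τ' : Matrix ((∀ i : {i // i ∈ S}, A i) × B) ((∀ i : {i // i ∈ S}, A i) × B) ℂ}
    {ρ ρ' : Matrix ((∀ i : {i // i ∈ S}, A i) × R) ((∀ i : {i // i ∈ S}, A i) × R) ℂ}
    (hτ : IsSubnormalised τ) (hτ' : τ'.PosSemidef) (hρ : ρ.PosSemidef)
    (hρ' : IsSubnormalised ρ') {ε : ℝ} (hτε : schattenNorm 1 (τ' - τ) ≤ ε)
    (hρε : schattenNorm 1 (ρ' - ρ) ≤ ε) {x y : ℝ} (hx : HasWeight ρ' x) (hy : HasWeight τ' y) :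
    ∃ g : (∀ i, Matrix.unitaryGroup (A i) ℂ) → ℝ, Continuous g ∧
      (∀ U, schattenNorm 1 (((∏ i : {i // i ∈ S}, (Fintype.card (A i) : ℝ) : ℝ) : ℂ) •
        link τ (centredProd S U) ρ) ≤ g U) ∧
      ∫ U, g U ∂piHaar A ≤ 2 * 2 ^ S.card * ε +
        (∏ s ∈ S, (1 - ((Fintype.card (A s) : ℝ) ^ 2)⁻¹) ^ (-1 / 2 : ℝ)) * (x * y) := by
  obtain ⟨H, ρ₀, hH, hρ₀, hH4, hρx, rfl⟩ := hx
  obtain ⟨G, τ₀, hG, hτ₀, hG4, hτy, rfl⟩ := hy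
  set ρ' := (1 ⊗ₖ H) * ρ₀ * (1 ⊗ₖ H) with hρ'def
  set τ' := (1 ⊗ₖ G) * τ₀ * (1 ⊗ₖ G) with hτ'def
  set d : ℝ := ∏ i : {i // i ∈ S}, (Fintype.card (A i) : ℝ) with hd
  have hdi : ∀ i, (2 : ℝ) ≤ Fintype.card (A i) := fun i => by exact_mod_cast hA i
  have hd0 : 0 < d := Finset.prod_pos fun i _ => by linarith [hdi i]
  obtain ⟨P, N, hP, hN, hPN, hPN'⟩ := exists_posSemidef_sub (hρ'.1.isHermitian.sub hρ.isHermitian)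
  obtain ⟨P', N', hP', hN', hPN₁, hPN₁'⟩ :=
    exists_posSemidef_sub (hτ'.isHermitian.sub hτ.1.isHermitian)
  have c1 := Complex.continuous_re.comp (continuous_trace_link_absProd S (τ + 0) (N + P))
  have c2 := Complex.continuous_re.comp (continuous_trace_link_absProd S (N' + P') (ρ' + 0))
  have c3 := continuous_frobNorm_link S τ₀ ρ₀
  refine ⟨fun U => d * ((link (τ + 0) (absProd S U) (N + P)).trace.re +
    (link (N' + P') (absProd S U) (ρ' + 0)).trace.re +
    frobNorm (link τ₀ (centredProd S U) ρ₀)), continuous_const.mul ((c1.add c2).add c3),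
    fun U => ?_, ?_⟩
  · have hF := isHermitian_centredProd S U
    refine (schattenNorm_one_smul_le (isHermitian_link hτ.1.isHermitian hF hρ.isHermitian)
      hd0.le).trans (mul_le_mul_of_nonneg_left ?_ hd0.le)
    have e : link τ (centredProd S U) ρ = link (τ - 0) (centredProd S U) (N - P) +
        link (N' - P') (centredProd S U) (ρ' - 0) + link τ' (centredProd S U) ρ' := by
      rw [show N - P = ρ - ρ' by rw [← neg_sub P N, ← hPN]; abel,
        show N' - P' = τ - τ' by rw [← neg_sub P' N', ← hPN₁]; abel]
      simp only [link_sub_left, link_sub_right, sub_zero]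
      abel
    have b1 := schattenNorm_one_link_centredProd_le S U hτ.1 Matrix.PosSemidef.zero hN hP
    have b2 := schattenNorm_one_link_centredProd_le S U hN' hP' hρ'.1 Matrix.PosSemidef.zero
    have b3 := schattenNorm_one_link_conj_le hF hG hH hτ₀ hρ₀ hG4 hH4
    have h1 := isHermitian_link (hτ.1.isHermitian.sub Matrix.isHermitian_zero) hF
      (hN.isHermitian.sub hP.isHermitian)
    have h2 := isHermitian_link (hN'.isHermitian.sub hP'.isHermitian) hF
      (hρ'.1.isHermitian.sub Matrix.isHermitian_zero)
    have h3 := isHermitian_link hτ'.isHermitian hF hρ'.1.isHermitian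
    rw [e]
    have t1 := schattenNorm_one_add_le (h1.add h2) h3
    have t2 := schattenNorm_one_add_le h1 h2
    linarith
  · have i1 := integrable_piHaar_of_continuous c1
    have i2 := integrable_piHaar_of_continuous c2
    simp only [Function.comp_def] at i1 i2
    rw [integral_const_mul, integral_add (by exact i1.add i2)
      (integrable_piHaar_of_continuous c3), integral_add i1 i2,
      integral_trace_link_absProd S (hτ.1.add Matrix.PosSemidef.zero),
      integral_trace_link_absProd S (hN'.add hP')]
    have i3 := integral_frobNorm_link_le S hA τ₀ ρ₀
    have hs : d * ∏ i : {i // i ∈ S}, 2 * (Fintype.card (A i) : ℝ)⁻¹ = 2 ^ S.card := by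
      rw [hd, ← Finset.prod_mul_distrib, ← Fintype.card_coe S, ← Finset.card_univ,
        ← Finset.prod_const]
      refine Finset.prod_congr rfl fun i _ => ?_
      have := hdi i
      field_simp
    have hk : d * √(∏ i : {i // i ∈ S}, ((Fintype.card (A i) : ℝ) ^ 2 - 1)⁻¹) =
        ∏ s ∈ S, (1 - ((Fintype.card (A s) : ℝ) ^ 2)⁻¹) ^ (-1 / 2 : ℝ) := by
      rw [hd, Real.sqrt_eq_rpow, ← Real.finsetProd_rpow _ _ fun i _ => inv_nonneg.2
        (by nlinarith [hdi i]), ← Finset.prod_mul_distrib, ← Finset.prod_coe_sort S]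
      refine Finset.prod_congr rfl fun i _ => ?_
      exact mul_inv_sq_sub_one_rpow (hdi i)
    have hp : 0 ≤ P.trace.re := (Complex.le_def.1 hP.trace_nonneg).1
    have hn : 0 ≤ N.trace.re := (Complex.le_def.1 hN.trace_nonneg).1
    have hp' : 0 ≤ P'.trace.re := (Complex.le_def.1 hP'.trace_nonneg).1
    have hn' : 0 ≤ N'.trace.re := (Complex.le_def.1 hN'.trace_nonneg).1
    have m1 : τ.trace.re * (N + P).trace.re ≤ ε := by
      rw [Matrix.trace_add, Complex.add_re]
      calc _ ≤ 1 * (N.trace.re + P.trace.re) := mul_le_mul_of_nonneg_right hτ.2 (by linarith)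
        _ ≤ ε := by linarith
    have m2 : (N' + P').trace.re * ρ'.trace.re ≤ ε := by
      rw [Matrix.trace_add, Complex.add_re]
      calc _ ≤ (N'.trace.re + P'.trace.re) * 1 := mul_le_mul_of_nonneg_left hρ'.2 (by linarith)
        _ ≤ ε := by linarith
    have m3 : frobNorm τ₀ * frobNorm ρ₀ ≤ x * y := by
      rw [mul_comm x y]
      exact mul_le_mul hτy hρx (frobNorm_nonneg _) ((frobNorm_nonneg _).trans hτy)
    simp only [add_zero]
    calc _ = d * (∏ i : {i // i ∈ S}, 2 * (Fintype.card (A i) : ℝ)⁻¹) *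
          (τ.trace.re * (N + P).trace.re + (N' + P').trace.re * ρ'.trace.re) +
          d * ∫ U, frobNorm (link τ₀ (centredProd S U) ρ₀) ∂piHaar A := by ring
      _ ≤ 2 ^ S.card * (ε + ε) + (∏ s ∈ S, (1 - ((Fintype.card (A s) : ℝ) ^ 2)⁻¹) ^
          (-1 / 2 : ℝ)) * (x * y) := by
        rw [hs]
        refine add_le_add (mul_le_mul_of_nonneg_left (add_le_add m1 m2) (by positivity)) ?_
        calc _ ≤ d * (√(∏ i : {i // i ∈ S}, ((Fintype.card (A i) : ℝ) ^ 2 - 1)⁻¹) *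
              (frobNorm τ₀ * frobNorm ρ₀)) := mul_le_mul_of_nonneg_left i3 hd0.le
          _ ≤ d * (√(∏ i : {i // i ∈ S}, ((Fintype.card (A i) : ℝ) ^ 2 - 1)⁻¹) * (x * y)) := by
            gcongr
          _ = _ := by rw [← mul_assoc, hk]
      _ = _ := by ring

end TermBound

section Renyi

variable {X Y : Type*} [Fintype X] [DecidableEq X] [Fintype Y] [DecidableEq Y]

lemma spectrum_nonneg {β : Matrix X X ℂ} (hβ : β.PosSemidef) {x : ℝ} (hx : x ∈ spectrum ℝ β) :
    0 ≤ x := by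
  have h := (Matrix.posSemidef_iff_isHermitian_and_spectrum_nonneg.1 hβ).2
  have hx' : (x : ℂ) ∈ spectrum ℂ β := by
    simpa using (spectrum.algebraMap_mem_iff ℂ (R := ℝ) (a := β) (r := x)).2 hx
  have := h hx'
  simpa using this

lemma suppPow_mul_suppPow {β : Matrix X X ℂ} (hβ : β.PosSemidef) (s t : ℝ) :
    suppPow β s * suppPow β t = suppPow β (s + t) := by
  rw [suppPow, suppPow, suppPow, ← cfc_mul_matrix]
  refine cfc_congr fun x hx => ?_
  by_cases h : x = 0
  · simp [h]
  · simp only [h, if_false]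
    exact (Real.rpow_add (lt_of_le_of_ne (spectrum_nonneg hβ hx) (Ne.symm h)) s t).symm

lemma suppPow_one {β : Matrix X X ℂ} (hβ : β.IsHermitian) : suppPow β 1 = β := by
  have : (fun x : ℝ => if x = 0 then 0 else x ^ (1 : ℝ)) = fun x => x := by
    ext x; split_ifs with h <;> simp [h]
  rw [suppPow, this, cfc_id' ℝ β hβ.isSelfAdjoint]

lemma isHermitian_suppPow (β : Matrix X X ℂ) (s : ℝ) : (suppPow β s).IsHermitian :=
  isHermitian_cfc _ β

lemma suppPow_zero_mul_of_supp_le {α β : Matrix X X ℂ} (hβ : β.PosSemidef)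
    (h : supp α ≤ supp β) : suppPow β 0 * α = α := by
  have hPβ : suppPow β 0 * β = β := by
    have := suppPow_mul_suppPow hβ 0 1
    rwa [zero_add, suppPow_one hβ.isHermitian] at this
  apply Matrix.mulVec_injective
  funext v
  obtain ⟨u, hu⟩ := h ⟨v, rfl⟩
  simp only [Matrix.mulVecLin_apply] at hu
  rw [← Matrix.mulVec_mulVec, ← hu, Matrix.mulVec_mulVec, hPβ]

lemma supp_le_of_ker_le {α β : Matrix X X ℂ} (hα : α.IsHermitian) (hβ : β.PosSemidef)
    (h : ∀ v, β.mulVec v = 0 → α.mulVec v = 0) : supp α ≤ supp β := by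
  have h1 := suppPow_one hβ.isHermitian
  have hβP : β * suppPow β 0 = β := by
    have := suppPow_mul_suppPow hβ 1 0
    rwa [add_zero, h1] at this
  have hαP : α * suppPow β 0 = α := by
    apply Matrix.mulVec_injective
    funext v
    have := h (v - (suppPow β 0).mulVec v) (by
      rw [Matrix.mulVec_sub, Matrix.mulVec_mulVec, hβP, sub_self])
    rw [Matrix.mulVec_sub, Matrix.mulVec_mulVec, sub_eq_zero] at this
    exact this.symm
  have hPα : β * (suppPow β (-1) * α) = α := by
    have h2 := suppPow_mul_suppPow hβ 1 (-1)
    rw [h1, add_neg_cancel] at h2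
    rw [← mul_assoc, h2]
    have := congrArg Matrix.conjTranspose hαP
    rwa [Matrix.conjTranspose_mul, hα.eq, (isHermitian_suppPow β 0).eq] at this
  rintro _ ⟨v, rfl⟩
  refine ⟨(suppPow β (-1) * α).mulVec v, ?_⟩
  simp only [Matrix.mulVecLin_apply]
  rw [Matrix.mulVec_mulVec, hPα]

/-- The embedding `M ↦ 1 ⊗ M`. -/
def oneKronecker (X Y : Type*) [Fintype X] [DecidableEq X] [Fintype Y] [DecidableEq Y] :
    Matrix Y Y ℂ →⋆ₐ[ℝ] Matrix (X × Y) (X × Y) ℂ where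
  toFun M := 1 ⊗ₖ M
  map_one' := Matrix.one_kronecker_one
  map_mul' M N := by rw [← Matrix.mul_kronecker_mul, one_mul]
  map_zero' := Matrix.kronecker_zero _
  map_add' M N := Matrix.kronecker_add _ _ _
  commutes' r := by
    rw [Algebra.algebraMap_eq_smul_one, Algebra.algebraMap_eq_smul_one, Matrix.kronecker_smul,
      Matrix.one_kronecker_one]
  map_star' M := by
    simp only [Matrix.star_eq_conjTranspose, Matrix.conjTranspose_kronecker,
      Matrix.conjTranspose_one]

lemma suppPow_one_kronecker {ζ : Matrix Y Y ℂ} (hζ : ζ.IsHermitian) (s : ℝ) :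
    suppPow ((1 : Matrix X X ℂ) ⊗ₖ ζ) s = 1 ⊗ₖ suppPow ζ s := by
  have hc : Continuous (oneKronecker X Y) := by
    refine continuous_matrix fun p q => ?_
    exact continuous_const.mul (continuous_id.matrix_elem p.2 q.2)
  have hH : ((1 : Matrix X X ℂ) ⊗ₖ ζ).IsHermitian := by
    rw [Matrix.IsHermitian, Matrix.conjTranspose_kronecker, hζ.eq, Matrix.conjTranspose_one]
  exact ((oneKronecker X Y).map_cfc _ ζ (continuousOn_spectrum _ ζ) hc hζ.isSelfAdjoint
    hH.isSelfAdjoint).symm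

lemma hasWeight_of_renyiDiv_lt {ζ : Matrix Y Y ℂ} (hζ : ζ.PosSemidef) (hζ1 : ζ.trace.re ≤ 1)
    {α : Matrix (X × Y) (X × Y) ℂ} (hα : α.IsHermitian) {x : ℝ}
    (h : renyiDiv α ((1 : Matrix X X ℂ) ⊗ₖ ζ) < (x : EReal)) :
    HasWeight α ((2 : ℝ) ^ (x / 2)) := by
  set β := (1 : Matrix X X ℂ) ⊗ₖ ζ with hβdef
  have hβ : β.PosSemidef := Matrix.PosSemidef.one.kronecker hζ
  have hs : supp α ≤ supp β := by
    by_contra hs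
    simp [renyiDiv, hs] at h
  rw [renyiDiv, if_pos hs, schattenNorm_two] at h
  set N := suppPow β (-1 / 4) * α * suppPow β (-1 / 4) with hN
  refine ⟨suppPow ζ (1 / 4), N, isHermitian_suppPow _ _, ?_, ?_, ?_, ?_⟩
  · have := Matrix.isHermitian_conjTranspose_mul_mul (suppPow β (-1 / 4)) hα
    rwa [(isHermitian_suppPow _ _).eq] at this
  · rw [suppPow_mul_suppPow hζ, suppPow_mul_suppPow hζ,
      show (1 / 4 + 1 / 4 + (1 / 4 + 1 / 4) : ℝ) = 1 by norm_num, suppPow_one hζ.isHermitian]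
    exact hζ1
  · rcases (frobNorm_nonneg N).eq_or_lt with h0 | h0
    · rw [← h0]; positivity
    · rw [elog2, if_neg (not_le.2 h0)] at h
      rw [show (2 : EReal) = ((2 : ℝ) : EReal) from rfl, ← EReal.coe_mul,
        EReal.coe_lt_coe_iff] at h
      have : Real.logb 2 (frobNorm N) ≤ x / 2 := by linarith
      exact (Real.logb_le_iff_le_rpow (by norm_num) h0).1 this
  · rw [← suppPow_one_kronecker hζ.isHermitian, ← hβdef]
    have hP := suppPow_zero_mul_of_supp_le hβ hs
    have hP' : α * suppPow β 0 = α := by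
      have := congrArg Matrix.conjTranspose hP
      rwa [Matrix.conjTranspose_mul, hα.eq, (isHermitian_suppPow β 0).eq] at this
    have e1 : suppPow β (1 / 4) * suppPow β (-1 / 4) = suppPow β 0 := by
      rw [suppPow_mul_suppPow hβ]; norm_num
    have e2 : suppPow β (-1 / 4) * suppPow β (1 / 4) = suppPow β 0 := by
      rw [suppPow_mul_suppPow hβ]; norm_num
    rw [hN, mul_assoc (suppPow β (-1 / 4)), ← mul_assoc (suppPow β (1 / 4)), e1, mul_assoc,
      mul_assoc, e2, hP', hP]

omit [DecidableEq X] [Fintype Y] [DecidableEq Y] in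
lemma traceFst_eq_sum (M : Matrix (X × Y) (X × Y) ℂ) :
    traceFst M = ∑ x, M.submatrix (fun y => (x, y)) fun y => (x, y) := by
  ext y y'
  simp [traceFst, Matrix.sum_apply]

omit [DecidableEq X] [Fintype Y] [DecidableEq Y] in
lemma posSemidef_traceFst {M : Matrix (X × Y) (X × Y) ℂ} (hM : M.PosSemidef) :
    (traceFst M).PosSemidef := by
  rw [traceFst_eq_sum]
  exact Matrix.posSemidef_sum _ fun x _ => hM.submatrix _

omit [DecidableEq X] [DecidableEq Y] in
lemma trace_traceFst (M : Matrix (X × Y) (X × Y) ℂ) : (traceFst M).trace = M.trace := by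
  simp only [traceFst, Matrix.trace, Matrix.diag, Matrix.of_apply, Fintype.sum_prod_type]
  exact Finset.sum_comm

lemma supp_le_supp_one_kronecker {ρ : Matrix (X × Y) (X × Y) ℂ} (hρ : ρ.PosSemidef) :
    supp ρ ≤ supp ((1 : Matrix X X ℂ) ⊗ₖ traceFst ρ) := by
  have hζ := posSemidef_traceFst hρ
  refine supp_le_of_ker_le hρ.isHermitian (Matrix.PosSemidef.one.kronecker hζ) fun v hv => ?_
  let w : X → X × Y → ℂ := fun x p => if p.1 = x then v p else 0
  have hvw : v = ∑ x, w x := by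
    ext p; simp [w, Finset.sum_apply]
  have hw : ∀ x, ρ.mulVec (w x) = 0 := by
    intro x
    have h1 : (traceFst ρ).mulVec (fun y => v (x, y)) = 0 := by
      ext y
      have := congrFun hv (x, y)
      simpa [Matrix.mulVec, dotProduct, Fintype.sum_prod_type, Matrix.one_apply] using this
    have h2 : ∀ z, 0 ≤ star (fun y => v (x, y)) ⬝ᵥ
        (ρ.submatrix (fun y => (z, y)) fun y => (z, y)).mulVec (fun y => v (x, y)) := fun z =>
      (hρ.submatrix fun y => (z, y)).dotProduct_mulVec_nonneg _
    have h3 : ∑ z, star (fun y => v (x, y)) ⬝ᵥ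
        (ρ.submatrix (fun y => (z, y)) fun y => (z, y)).mulVec (fun y => v (x, y)) = 0 := by
      rw [← dotProduct_sum, ← Matrix.sum_mulVec, ← traceFst_eq_sum, h1, dotProduct_zero]
    have h4 := (Finset.sum_eq_zero_iff_of_nonneg fun z _ => h2 z).1 h3 x (Finset.mem_univ x)
    refine (hρ.dotProduct_mulVec_zero_iff (w x)).1 ?_
    rw [← h4]
    simp only [w, Matrix.mulVec, dotProduct, Fintype.sum_prod_type_right, Pi.star_apply,
      apply_ite (star : ℂ → ℂ), star_zero, ite_mul, zero_mul, mul_ite, mul_zero,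
      Finset.sum_ite_eq', Finset.mem_univ, if_true, Matrix.submatrix_apply]
  rw [hvw, Matrix.mulVec_sum]
  exact Finset.sum_eq_zero fun x _ => hw x

lemma smoothRenyiDiv_lt_top {ρ : Matrix (X × Y) (X × Y) ℂ} (hρ : IsSubnormalised ρ) {ε : ℝ}
    (hε : 0 ≤ ε) : smoothRenyiDiv ε ρ ((1 : Matrix X X ℂ) ⊗ₖ traceFst ρ) < ⊤ := by
  have h0 : schattenNorm 1 (ρ - ρ) ≤ ε * ρ.trace.re := by
    have := schattenNorm_one_sub_le (X := X × Y) Matrix.PosSemidef.zero Matrix.PosSemidef.zero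
    rw [sub_self]
    simp only [sub_self, Matrix.trace_zero, Complex.zero_re, add_zero] at this
    exact this.trans (mul_nonneg hε (Complex.le_def.1 hρ.1.trace_nonneg).1)
  refine (iInf₂_le ρ ⟨hρ, h0⟩).trans_lt ?_
  rw [renyiDiv, if_pos (supp_le_supp_one_kronecker hρ.1), elog2]
  split_ifs
  · rw [EReal.mul_bot_of_pos (by norm_num)]; exact bot_lt_top
  · rw [show (2 : EReal) = ((2 : ℝ) : EReal) from rfl, ← EReal.coe_mul]
    exact EReal.coe_lt_top _

lemma exists_hasWeight {ρ : Matrix (X × Y) (X × Y) ℂ} (hρ : IsSubnormalised ρ) {ε x : ℝ}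
    (hε : 0 ≤ ε) (h : smoothRenyiDiv ε ρ ((1 : Matrix X X ℂ) ⊗ₖ traceFst ρ) < (x : EReal)) :
    ∃ ρ', IsSubnormalised ρ' ∧ schattenNorm 1 (ρ' - ρ) ≤ ε ∧
      HasWeight ρ' ((2 : ℝ) ^ (x / 2)) := by
  rw [smoothRenyiDiv, iInf_lt_iff] at h
  obtain ⟨ρ', h⟩ := h
  obtain ⟨⟨hρ', hd⟩, hlt⟩ := iInf_lt_iff.1 h
  refine ⟨ρ', hρ', hd.trans ?_, hasWeight_of_renyiDiv_lt (posSemidef_traceFst hρ.1)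
    (by rw [trace_traceFst]; exact hρ.2) hρ'.1.isHermitian hlt⟩
  calc ε * ρ.trace.re ≤ ε * 1 := mul_le_mul_of_nonneg_left hρ.2 hε
    _ = ε := mul_one ε

end Renyi

section Decomposition

variable {k : ℕ} {A : Fin k → Type*} [∀ i, Fintype (A i)] [∀ i, DecidableEq (A i)] {B R C : Type*}

lemma link_apply_eq_sum {X Y : Type*} [Fintype X] [Fintype Y] (τ : Matrix (X × B) (X × B) ℂ)
    (F : Matrix (X × Y) (X × Y) ℂ) (ρ : Matrix (Y × R) (Y × R) ℂ) (p q : B × R) :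
    link τ F ρ p q = ∑ a, ∑ a', τ (a, p.1) (a', q.1) *
      ∑ c, ∑ c', ρ (c, p.2) (c', q.2) * F (a, c) (a', c') := by
  simp only [link, Matrix.of_apply, Fintype.sum_prod_type, Finset.mul_sum]
  refine Finset.sum_congr rfl fun a _ => ?_
  rw [Finset.sum_comm]
  refine Finset.sum_congr rfl fun a' _ => Finset.sum_congr rfl fun c _ =>
    Finset.sum_congr rfl fun c' _ => ?_
  ring

lemma eprAll_apply (x a x' a' : ∀ i, A i) :
    eprAll A (x, a) (x', a') =
      if x = a ∧ x' = a' then (∏ i, (Fintype.card (A i) : ℂ))⁻¹ else 0 := by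
  simp only [eprAll, epr, Matrix.of_apply, Finset.prod_ite_zero, Finset.prod_inv_distrib]
  refine if_congr ?_ rfl rfl
  simp [funext_iff, forall_and]

lemma choiState_apply (T : Matrix (∀ i, A i) (∀ i, A i) ℂ →ₗ[ℂ] Matrix B B ℂ)
    (a a' : ∀ i, A i) (b b' : B) :
    choiState T (a, b) (a', b') =
      (∏ i, (Fintype.card (A i) : ℂ))⁻¹ * T (Matrix.single a a' 1) b b' := by
  have h : (Matrix.of fun x x' => eprAll A (x, a) (x', a')) =
      (∏ i, (Fintype.card (A i) : ℂ))⁻¹ • Matrix.single a a' (1 : ℂ) := by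
    ext x x'
    simp [eprAll_apply, Matrix.single_apply, eq_comm]
  simp only [choiState, Matrix.submatrix_apply, ampliate, Matrix.of_apply, Prod.swap, h, map_smul,
    Matrix.smul_apply, smul_eq_mul]

lemma map_apply_eq_sum {X : Type*} [Fintype X] [DecidableEq X]
    (T : Matrix X X ℂ →ₗ[ℂ] Matrix B B ℂ) (M : Matrix X X ℂ) (b b' : B) :
    T M b b' = ∑ a, ∑ a', M a a' * T (Matrix.single a a' 1) b b' := by
  conv_lhs => rw [Matrix.matrix_eq_sum_single M]
  simp only [map_sum, Matrix.sum_apply]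
  refine Finset.sum_congr rfl fun a _ => Finset.sum_congr rfl fun a' _ => ?_
  rw [show Matrix.single a a' (M a a') = M a a' • Matrix.single a a' (1 : ℂ) by
    rw [Matrix.smul_single, smul_eq_mul, mul_one], map_smul, Matrix.smul_apply, smul_eq_mul]

omit [∀ i, DecidableEq (A i)] in
lemma prod_card_ne_zero (hA : ∀ i, 2 ≤ Fintype.card (A i)) :
    (∏ i, (Fintype.card (A i) : ℂ)) ≠ 0 :=
  Finset.prod_ne_zero_iff.2 fun i _ => by exact_mod_cast (by have := hA i; omega)

lemma perturbedState_eq (hA : ∀ i, 2 ≤ Fintype.card (A i)) [Fintype R] [DecidableEq R]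
    (T : Matrix (∀ i, A i) (∀ i, A i) ℂ →ₗ[ℂ] Matrix B B ℂ)
    (ρ : Matrix ((∀ i, A i) × R) ((∀ i, A i) × R) ℂ) (U : ∀ i, Matrix.unitaryGroup (A i) ℂ) :
    perturbedState T ρ U = (∏ i, (Fintype.card (A i) : ℂ)) •
      link (choiState T) (prodKernel fun i => unitKernel (U i).1) ρ := by
  ext p q
  rw [Matrix.smul_apply, link_apply_eq_sum, perturbedState, ampliate, Matrix.of_apply,
    map_apply_eq_sum, smul_eq_mul, Finset.mul_sum]
  refine Finset.sum_congr rfl fun a _ => ?_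
  rw [Finset.mul_sum]
  refine Finset.sum_congr rfl fun a' _ => ?_
  rw [choiState_apply, ← mul_assoc, ← mul_assoc, mul_inv_cancel₀ (prod_card_ne_zero hA), one_mul,
    mul_comm]
  congr 1
  simp only [Matrix.of_apply, Matrix.mul_apply, Matrix.conjTranspose_apply,
    Fintype.sum_prod_type, Matrix.kroneckerMap_apply, Matrix.one_apply, mul_ite, mul_one, mul_zero,
    ite_mul, zero_mul, Finset.sum_ite_eq, Finset.mem_univ, if_true, apply_ite (star : ℂ → ℂ),
    star_zero, Finset.sum_mul]
  rw [Finset.sum_comm]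
  refine Finset.sum_congr rfl fun c _ => Finset.sum_congr rfl fun c' _ => ?_
  simp only [tensorOp, Matrix.of_apply, prodKernel_apply, unitKernel, star_prod,
    Finset.prod_mul_distrib]
  ring

lemma sum_marginal (S : Finset (Fin k)) (M : Matrix ((∀ i, A i) × C) ((∀ i, A i) × C) ℂ)
    (f : (∀ i : {i // i ∈ S}, A i) → (∀ i : {i // i ∈ S}, A i) → ℂ) (r r' : C) :
    ∑ c, ∑ c', M (c, r) (c', r') *
      (f (fun i => c i) (fun i => c' i) *
        if (fun i : {i // ¬ i ∈ S} => c i) = (fun i : {i // ¬ i ∈ S} => c' i) then 1 else 0) =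
      ∑ x, ∑ x', marginal S M (x, r) (x', r') * f x x' := by
  let e := Equiv.piEquivPiSubtypeProd (· ∈ S) A
  have e1 : ∀ p, (fun i : {i // i ∈ S} => e.symm p i) = p.1 := fun p =>
    congrArg Prod.fst (e.apply_symm_apply p)
  have e2 : ∀ p, (fun i : {i // ¬ i ∈ S} => e.symm p i) = p.2 := fun p =>
    congrArg Prod.snd (e.apply_symm_apply p)
  rw [← e.symm.sum_comp]
  have : ∀ c, ∑ c', M (c, r) (c', r') * (f (fun i => c i) (fun i => c' i) *
        if (fun i : {i // ¬ i ∈ S} => c i) = (fun i : {i // ¬ i ∈ S} => c' i) then 1 else 0) =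
      ∑ p, M (c, r) (e.symm p, r') * (f (fun i => c i) p.1 *
        if (fun i : {i // ¬ i ∈ S} => c i) = p.2 then 1 else 0) := by
    intro c
    rw [← e.symm.sum_comp]
    exact Finset.sum_congr rfl fun p _ => by rw [e1, e2]
  simp only [this]
  simp only [e1, e2, Fintype.sum_prod_type, mul_ite, mul_one, mul_zero, Finset.sum_ite_eq,
    Finset.mem_univ, if_true]
  refine Finset.sum_congr rfl fun x _ => ?_
  rw [Finset.sum_comm]
  refine Finset.sum_congr rfl fun x' _ => ?_
  simp only [marginal, Matrix.of_apply, Finset.sum_mul]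
  rfl

lemma prod_eq_prod_mem_mul_prod_notMem (S : Finset (Fin k)) (f : Fin k → ℂ) :
    ∏ i, f i = (∏ i : {i // i ∈ S}, f i) * ∏ i : {i // ¬ i ∈ S}, f i := by
  rw [← Fintype.prod_subtype_mul_prod_subtype (· ∈ S)]
  congr!

lemma smul_link_eq_marginal (hA : ∀ i, 2 ≤ Fintype.card (A i)) (S : Finset (Fin k))
    (τ : Matrix ((∀ i, A i) × B) ((∀ i, A i) × B) ℂ)
    (ρ : Matrix ((∀ i, A i) × R) ((∀ i, A i) × R) ℂ) (U : ∀ i, Matrix.unitaryGroup (A i) ℂ) :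
    (∏ i, (Fintype.card (A i) : ℂ)) • link τ (prodKernel fun i =>
      if i ∈ S then centredKernel (U i).1 else (Fintype.card (A i) : ℂ)⁻¹ • 1) ρ =
    (∏ i : {i // i ∈ S}, (Fintype.card (A i) : ℂ)) •
      link (marginal S τ) (centredProd S U) (marginal S ρ) := by
  have hd := prod_card_ne_zero hA
  rw [prod_eq_prod_mem_mul_prod_notMem S] at hd
  have hF : ∀ a c a' c', (prodKernel fun i =>
      if i ∈ S then centredKernel (U i).1 else (Fintype.card (A i) : ℂ)⁻¹ • 1) (a, c) (a', c') =
      (∏ i : {i // ¬ i ∈ S}, (Fintype.card (A i) : ℂ))⁻¹ *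
      ((centredProd S U (fun i => a i, fun i => c i) (fun i => a' i, fun i => c' i) *
        if (fun i : {i // ¬ i ∈ S} => c i) = (fun i : {i // ¬ i ∈ S} => c' i) then 1 else 0) *
        if (fun i : {i // ¬ i ∈ S} => a i) = (fun i : {i // ¬ i ∈ S} => a' i) then 1 else 0) := by
    intro a c a' c'
    rw [prodKernel_apply, prod_eq_prod_mem_mul_prod_notMem S]
    have h1 : ∏ i : {i // i ∈ S}, (if (i : Fin k) ∈ S then centredKernel (U i).1
        else (Fintype.card (A i) : ℂ)⁻¹ • 1) (a i, c i) (a' i, c' i) =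
        centredProd S U (fun i => a i, fun i => c i) (fun i => a' i, fun i => c' i) := by
      rw [centredProd, prodKernel_apply]
      exact Finset.prod_congr rfl fun i _ => by rw [if_pos i.2]
    have h2 : ∏ i : {i // ¬ i ∈ S}, (if (i : Fin k) ∈ S then centredKernel (U i).1
        else (Fintype.card (A i) : ℂ)⁻¹ • 1) (a i, c i) (a' i, c' i) =
        (∏ i : {i // ¬ i ∈ S}, (Fintype.card (A i) : ℂ))⁻¹ *
        ((if (fun i : {i // ¬ i ∈ S} => c i) = (fun i : {i // ¬ i ∈ S} => c' i) then 1 else 0) *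
        if (fun i : {i // ¬ i ∈ S} => a i) = (fun i : {i // ¬ i ∈ S} => a' i) then 1 else 0) := by
      have : ∀ i : {i // ¬ i ∈ S}, (if (i : Fin k) ∈ S then centredKernel (U i).1
          else (Fintype.card (A i) : ℂ)⁻¹ • 1) (a i, c i) (a' i, c' i) =
          (Fintype.card (A i) : ℂ)⁻¹ *
            if c i = c' i ∧ a i = a' i then 1 else 0 := by
        intro i
        rw [if_neg i.2]
        simp [Matrix.one_apply, and_comm]
      simp only [this, Finset.prod_mul_distrib, Finset.prod_inv_distrib, Finset.prod_ite_zero,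
        Finset.prod_const_one]
      congr 1
      rw [ite_zero_mul_ite_zero, one_mul]
      refine if_congr ?_ rfl rfl
      simp [funext_iff, forall_and]
    dsimp only
    rw [h1, h2]
    ring
  ext p q
  rw [Matrix.smul_apply, Matrix.smul_apply, link_apply_eq_sum, link_apply_eq_sum,
    ← sum_marginal S τ (fun x x' => ∑ c, ∑ c', marginal S ρ (c, p.2) (c', q.2) *
      centredProd S U (x, c) (x', c'))]
  simp only [← sum_marginal S ρ (fun c c' => centredProd S U (_, c) (_, c'))]
  rw [prod_eq_prod_mem_mul_prod_notMem S, mul_smul]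
  congr 1
  rw [smul_eq_mul, Finset.mul_sum]
  refine Finset.sum_congr rfl fun a _ => ?_
  rw [Finset.mul_sum]
  refine Finset.sum_congr rfl fun a' _ => ?_
  rw [← mul_assoc, mul_comm _ (τ _ _), mul_assoc]
  congr 1
  rw [Finset.sum_mul, Finset.mul_sum]
  refine Finset.sum_congr rfl fun c _ => ?_
  rw [Finset.sum_mul, Finset.mul_sum]
  refine Finset.sum_congr rfl fun c' _ => ?_
  rw [hF]
  have := right_ne_zero_of_mul hd
  field_simp

lemma link_one [Fintype B] [Fintype R] {X Y : Type*} [Fintype X] [Fintype Y] [DecidableEq X]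
    [DecidableEq Y] (τ : Matrix (X × B) (X × B) ℂ) (ρ : Matrix (Y × R) (Y × R) ℂ) :
    link τ 1 ρ = traceFst τ ⊗ₖ traceFst ρ := by
  ext p q
  simp only [link, Matrix.of_apply, Matrix.one_apply, mul_ite, mul_one, mul_zero, ite_mul, zero_mul,
    Finset.sum_ite_eq, Finset.mem_univ, if_true, Fintype.sum_prod_type, traceFst,
    Matrix.kroneckerMap_apply, Finset.sum_mul_sum]

/-- Decomposition of the perturbed state into contributions of sets of systems. -/
lemma perturbedState_sub_eq (hA : ∀ i, 2 ≤ Fintype.card (A i)) [Fintype B] [Fintype R]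
    [DecidableEq R] (T : Matrix (∀ i, A i) (∀ i, A i) ℂ →ₗ[ℂ] Matrix B B ℂ)
    (ρ : Matrix ((∀ i, A i) × R) ((∀ i, A i) × R) ℂ) (U : ∀ i, Matrix.unitaryGroup (A i) ℂ) :
    perturbedState T ρ U - traceFst (choiState T) ⊗ₖ traceFst ρ =
      ∑ S : Finset (Fin k) with S.Nonempty, (∏ i : {i // i ∈ S}, (Fintype.card (A i) : ℂ)) •
        link (marginal S (choiState T)) (centredProd S U) (marginal S ρ) := by
  have h1 : (fun i => unitKernel (U i).1) =
      fun i => centredKernel (U i).1 + (Fintype.card (A i) : ℂ)⁻¹ • 1 := by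
    ext i : 1; rw [centredKernel_eq]; abel
  rw [perturbedState_eq hA, h1, prodKernel_add, link_sum_mid, Finset.smul_sum,
    ← Finset.sum_filter_add_sum_filter_not _ fun S : Finset (Fin k) => S.Nonempty]
  have h2 : (Finset.univ.filter fun S : Finset (Fin k) => ¬ S.Nonempty) = {∅} := by
    ext S; simp
  have hd := prod_card_ne_zero hA
  rw [h2, Finset.sum_singleton]
  simp only [Finset.notMem_empty, if_false]
  rw [prodKernel_smul, prodKernel_one, Finset.prod_inv_distrib]
  have h3 : (∏ i, (Fintype.card (A i) : ℂ)) • link (choiState T)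
      ((∏ i, (Fintype.card (A i) : ℂ))⁻¹ • 1) ρ = traceFst (choiState T) ⊗ₖ traceFst ρ := by
    rw [← link_one]
    ext p q
    simp only [link, Matrix.of_apply, Matrix.smul_apply, smul_eq_mul, Finset.mul_sum]
    refine Finset.sum_congr rfl fun k _ => Finset.sum_congr rfl fun k' _ => ?_
    field_simp
  rw [h3, add_sub_cancel_right]
  exact Finset.sum_congr rfl fun S _ => smul_link_eq_marginal hA S _ ρ U

omit [∀ i, DecidableEq (A i)] in
lemma isSubnormalised_marginal [Fintype C] (S : Finset (Fin k))
    {M : Matrix ((∀ i, A i) × C) ((∀ i, A i) × C) ℂ} (hM : IsSubnormalised M) :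
    IsSubnormalised (marginal S M) := by
  constructor
  · have : marginal S M = ∑ z : (∀ i : {i // ¬ i ∈ S}, A i), M.submatrix
        (fun p => ((Equiv.piEquivPiSubtypeProd (· ∈ S) A).symm (p.1, z), p.2))
        (fun p => ((Equiv.piEquivPiSubtypeProd (· ∈ S) A).symm (p.1, z), p.2)) := by
      ext p q
      simp [marginal, Matrix.sum_apply]
    rw [this]
    exact Matrix.posSemidef_sum _ fun z _ => hM.1.submatrix _
  · have : (marginal S M).trace = M.trace := by
      simp only [Matrix.trace, Matrix.diag, Fintype.sum_prod_type_right]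
      refine Finset.sum_congr rfl fun r _ => ?_
      rw [← (Equiv.piEquivPiSubtypeProd (· ∈ S) A).symm.sum_comp]
      conv_rhs => rw [Fintype.sum_prod_type]
      rfl
    rw [this]; exact hM.2

lemma isSubnormalised_choiState (hA : ∀ i, 2 ≤ Fintype.card (A i)) [Fintype B]
    {T : Matrix (∀ i, A i) (∀ i, A i) ℂ →ₗ[ℂ] Matrix B B ℂ}
    (hT : IsCompletelyPositive T) (hT' : IsTraceNonincreasing T) :
    IsSubnormalised (choiState T) := by
  have hd0 : (0 : ℝ) < ∏ i, (Fintype.card (A i) : ℝ) :=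
    Finset.prod_pos fun i _ => by exact_mod_cast (by have := hA i; omega)
  constructor
  · have hE : (eprAll A).PosSemidef := by
      have h : eprAll A = (∏ i, (Fintype.card (A i) : ℂ))⁻¹ • Matrix.vecMulVec
          (fun p : (∀ i, A i) × (∀ i, A i) => if p.1 = p.2 then (1 : ℂ) else 0)
          (star fun p : (∀ i, A i) × (∀ i, A i) => if p.1 = p.2 then (1 : ℂ) else 0) := by
        ext p q
        rw [eprAll_apply p.1 p.2 q.1 q.2]
        by_cases h1 : p.1 = p.2 <;> by_cases h2 : q.1 = q.2 <;>
          simp [Matrix.vecMulVec_apply, h1, h2]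
      rw [h]
      refine (Matrix.posSemidef_vecMulVec_self_star _).smul ?_
      have : (∏ i, (Fintype.card (A i) : ℂ))⁻¹ =
          (((∏ i, (Fintype.card (A i) : ℝ))⁻¹ : ℝ) : ℂ) := by push_cast; rfl
      rw [this]
      exact_mod_cast (inv_pos.2 hd0).le
    let e := Fintype.equivFin (∀ i, A i)
    have h := hT _ ((eprAll A).submatrix (Prod.map id e.symm) (Prod.map id e.symm))
      (hE.submatrix _)
    have h2 := h.submatrix (fun p : (∀ i, A i) × B => (p.2, e p.1))
    have h3 : choiState T = (ampliate (Fin _) T ((eprAll A).submatrix (Prod.map id e.symm)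
        (Prod.map id e.symm))).submatrix (fun p : (∀ i, A i) × B => (p.2, e p.1))
        (fun p : (∀ i, A i) × B => (p.2, e p.1)) := by
      ext p q
      simp [choiState, ampliate]
    rw [h3]
    exact h2
  · have h1 : (choiState T).trace =
        (((∏ i, (Fintype.card (A i) : ℝ))⁻¹ : ℝ) : ℂ) * (T 1).trace := by
      simp only [Matrix.trace, Matrix.diag, Fintype.sum_prod_type_right, Finset.mul_sum]
      refine Finset.sum_congr rfl fun b _ => ?_
      rw [map_apply_eq_sum T 1, Finset.mul_sum]
      refine Finset.sum_congr rfl fun a _ => ?_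
      rw [choiState_apply]
      simp [Matrix.one_apply]
    have h2 := hT' 1 Matrix.PosSemidef.one
    rw [Matrix.trace_one, Fintype.card_pi] at h2
    rw [h1, Complex.re_ofReal_mul]
    have h3 : ((∏ i, Fintype.card (A i) : ℕ) : ℂ).re = ∏ i, (Fintype.card (A i) : ℝ) := by
      rw [Complex.natCast_re]; push_cast; rfl
    rw [h3] at h2
    calc _ ≤ (∏ i, (Fintype.card (A i) : ℝ))⁻¹ * ∏ i, (Fintype.card (A i) : ℝ) :=
          mul_le_mul_of_nonneg_left h2 (inv_pos.2 hd0).le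
      _ = 1 := inv_mul_cancel₀ hd0.ne'

end Decomposition

section Optimisation

lemma exists_rpow_mul_le {c δ : ℝ} (hc : 0 ≤ c) (hδ : 0 < δ) (y : ℝ) :
    ∃ x : ℝ, c * ((2 : ℝ) ^ (x / 2) * (2 : ℝ) ^ (y / 2)) ≤ δ := by
  have hy : (0 : ℝ) < 2 ^ (y / 2) := by positivity
  have hz : 0 < δ / ((c + 1) * 2 ^ (y / 2)) := by positivity
  refine ⟨2 * Real.logb 2 (δ / ((c + 1) * 2 ^ (y / 2))), ?_⟩
  rw [mul_div_cancel_left₀ _ (two_ne_zero), Real.rpow_logb (by norm_num) (by norm_num) hz]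
  have : δ / ((c + 1) * 2 ^ (y / 2)) * 2 ^ (y / 2) = δ / (c + 1) := by field_simp
  rw [this, mul_div_assoc', div_le_iff₀ (by positivity)]
  nlinarith

lemma exists_real_gt_rpow_le (a b : ℝ) {c δ : ℝ} (hδ : 0 < δ) :
    ∃ x y : ℝ, a < x ∧ b < y ∧ c * ((2 : ℝ) ^ (x / 2) * (2 : ℝ) ^ (y / 2)) ≤
      c * (2 : ℝ) ^ ((a + b) / 2) + δ := by
  have hcont : Continuous fun t : ℝ =>
      c * ((2 : ℝ) ^ ((a + t) / 2) * (2 : ℝ) ^ ((b + t) / 2)) := by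
    have : ∀ u : ℝ, Continuous fun t : ℝ => (2 : ℝ) ^ ((u + t) / 2) := fun u =>
      Continuous.rpow continuous_const (by fun_prop) fun _ => Or.inl two_ne_zero
    exact continuous_const.mul ((this a).mul (this b))
  have h0 : c * ((2 : ℝ) ^ ((a + 0) / 2) * (2 : ℝ) ^ ((b + 0) / 2)) <
      c * (2 : ℝ) ^ ((a + b) / 2) + δ := by
    rw [← Real.rpow_add two_pos, add_zero, add_zero, ← add_div]; linarith
  have hev := (hcont.tendsto 0).eventually_lt_const h0
  obtain ⟨t, ht, ht0⟩ := ((hev.filter_mono nhdsWithin_le_nhds).and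
    (self_mem_nhdsWithin (s := Set.Ioi (0 : ℝ)))).exists
  exact ⟨a + t, b + t, by simpa using ht0, by simpa using ht0, ht.le⟩

lemma exists_real_gt_le_epow2 {a b : EReal} (ha : a < ⊤) (hb : b < ⊤) {c δ : ℝ} (hc : 0 ≤ c)
    (hδ : 0 < δ) :
    ∃ x y : ℝ, a < x ∧ b < y ∧
      ENNReal.ofReal (c * ((2 : ℝ) ^ (x / 2) * (2 : ℝ) ^ (y / 2))) ≤ ENNReal.ofReal c *
        epow2 (-((1 / 2 : ℝ) : EReal) * -a - ((1 / 2 : ℝ) : EReal) * -b) + ENNReal.ofReal δ := by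
  induction a using EReal.rec with
  | top => exact absurd ha (lt_irrefl _)
  | bot =>
    obtain ⟨y, hy, -⟩ := EReal.lt_iff_exists_real_btwn.1 hb
    obtain ⟨x, hx⟩ := exists_rpow_mul_le hc hδ y
    exact ⟨x, y, EReal.bot_lt_coe x, hy, (ENNReal.ofReal_le_ofReal hx).trans le_add_self⟩
  | coe a =>
    induction b using EReal.rec with
    | top => exact absurd hb (lt_irrefl _)
    | bot =>
      obtain ⟨y, hy⟩ := exists_rpow_mul_le hc hδ (a + 1)
      refine ⟨a + 1, y, by exact_mod_cast lt_add_one a, EReal.bot_lt_coe y,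
        (ENNReal.ofReal_le_ofReal ?_).trans le_add_self⟩
      rwa [mul_comm ((2 : ℝ) ^ (_ : ℝ))]
    | coe b =>
      obtain ⟨x, y, hx, hy, h⟩ := exists_real_gt_rpow_le a b (c := c) hδ
      refine ⟨x, y, by exact_mod_cast hx, by exact_mod_cast hy, ?_⟩
      have he : -((1 / 2 : ℝ) : EReal) * -(a : EReal) - ((1 / 2 : ℝ) : EReal) * -(b : EReal) =
          (((a + b) / 2 : ℝ) : EReal) := by
        rw [← EReal.coe_neg, ← EReal.coe_neg, ← EReal.coe_neg, ← EReal.coe_mul, ← EReal.coe_mul,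
          ← EReal.coe_sub]
        congr 1; ring
      rw [he, epow2, if_neg (EReal.coe_ne_bot _), if_neg (EReal.coe_ne_top _), EReal.toReal_coe,
        ← ENNReal.ofReal_mul hc, ← ENNReal.ofReal_add (by positivity) hδ.le]
      exact ENNReal.ofReal_le_ofReal h

lemma schattenNorm_one_nonneg {X : Type*} [Fintype X] [DecidableEq X] {M : Matrix X X ℂ}
    (hM : M.IsHermitian) : 0 ≤ schattenNorm 1 M := by
  obtain ⟨P, N, hP, hN, -, h⟩ := exists_posSemidef_sub hM
  rw [h]
  exact add_nonneg (Complex.le_def.1 hP.trace_nonneg).1 (Complex.le_def.1 hN.trace_nonneg).1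

lemma prod_le_coeffD {k : ℕ} (A : Fin k → Type*) [∀ i, Fintype (A i)]
    (hA : ∀ i, 2 ≤ Fintype.card (A i)) {S : Finset (Fin k)} (hS : S.Nonempty) :
    0 ≤ ∏ s ∈ S, (1 - ((Fintype.card (A s) : ℝ) ^ 2)⁻¹) ^ (-1 / 2 : ℝ) ∧
    ∏ s ∈ S, (1 - ((Fintype.card (A s) : ℝ) ^ 2)⁻¹) ^ (-1 / 2 : ℝ) ≤
      2 ^ S.card * coeffD A S := by
  have h0 : 0 ≤ ∏ s ∈ S, (1 - ((Fintype.card (A s) : ℝ) ^ 2)⁻¹) ^ (-1 / 2 : ℝ) := by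
    refine Finset.prod_nonneg fun s _ => Real.rpow_nonneg (sub_nonneg.2 ?_) _
    have : (2 : ℝ) ≤ Fintype.card (A s) := by exact_mod_cast hA s
    exact inv_le_one_of_one_le₀ (by nlinarith)
  refine ⟨h0, ?_⟩
  have h1 : (1 : ℝ) ≤ 2 ^ S.card := one_le_pow₀ (by norm_num)
  have h2 : (1 : ℝ) ≤ 2 ^ ((S.card : ℤ) - 1) :=
    one_le_zpow₀ (by norm_num) (by have := hS.card_pos; omega)
  rw [coeffD, ← mul_assoc]
  exact le_mul_of_one_le_left h0 (one_le_mul_of_one_le_of_one_le h1 h2)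

lemma sum_two_pow_card (k : ℕ) :
    ∑ S : Finset (Fin k) with S.Nonempty, (2 : ℝ) ^ S.card = 3 ^ k - 1 := by
  have h := Finset.sum_filter_add_sum_filter_not (Finset.univ : Finset (Finset (Fin k)))
    (fun S => S.Nonempty) fun S => (2 : ℝ) ^ S.card
  have h2 : (Finset.univ.filter fun S : Finset (Fin k) => ¬ S.Nonempty) = {∅} := by
    ext S; simp
  have h3 : ∑ S : Finset (Fin k), (2 : ℝ) ^ S.card = 3 ^ k := by
    have := Fintype.sum_pow_mul_eq_add_pow (Fin k) (2 : ℝ) 1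
    simp only [one_pow, mul_one, Fintype.card_fin] at this
    rw [this]; norm_num
  rw [h2, h3, Finset.sum_singleton, Finset.card_empty, pow_zero] at h
  linarith

end Optimisation

section Main

variable {k : ℕ} {A : Fin k → Type*} [∀ i, Fintype (A i)] [∀ i, DecidableEq (A i)]
  {B R : Type*} [Fintype B] [DecidableEq B] [Fintype R] [DecidableEq R]

lemma exists_continuous_bound_entropy (hA : ∀ i, 2 ≤ Fintype.card (A i))
    {τ : Matrix ((∀ i, A i) × B) ((∀ i, A i) × B) ℂ} (hτ : IsSubnormalised τ)
    {ρ : Matrix ((∀ i, A i) × R) ((∀ i, A i) × R) ℂ} (hρ : IsSubnormalised ρ)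
    {ε δ : ℝ} (hε : 0 ≤ ε) (hδ : 0 < δ) {S : Finset (Fin k)} (hS : S.Nonempty) :
    ∃ g : (∀ i, Matrix.unitaryGroup (A i) ℂ) → ℝ, Continuous g ∧
      (∀ U, schattenNorm 1 ((∏ i : {i // i ∈ S}, (Fintype.card (A i) : ℂ)) •
        link (marginal S τ) (centredProd S U) (marginal S ρ)) ≤ g U) ∧
      ENNReal.ofReal (∫ U, g U ∂piHaar A) ≤ ENNReal.ofReal (2 * 2 ^ S.card * ε) +
        (ENNReal.ofReal (2 ^ S.card * coeffD A S) *
          epow2 (-((1 / 2 : ℝ) : EReal) * smoothCondEntropy ε (marginal S ρ) -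
            ((1 / 2 : ℝ) : EReal) * smoothCondEntropy ε (marginal S τ)) + ENNReal.ofReal δ) := by
  have hτ' := isSubnormalised_marginal S hτ
  have hρ' := isSubnormalised_marginal S hρ
  obtain ⟨hp0, hp⟩ := prod_le_coeffD A hA hS
  obtain ⟨x, y, hx, hy, hxy⟩ := exists_real_gt_le_epow2 (smoothRenyiDiv_lt_top hρ' hε)
    (smoothRenyiDiv_lt_top hτ' hε) (hp0.trans hp) hδ
  obtain ⟨ρ', hρ's, hρd, hρw⟩ := exists_hasWeight hρ' hε hx
  obtain ⟨τ', hτ's, hτd, hτw⟩ := exists_hasWeight hτ' hε hy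
  obtain ⟨g, hg, hgU, hgi⟩ := exists_continuous_bound S hA hτ' hτ's.1 hρ'.1 hρ's hτd hρd hρw hτw
  refine ⟨g, hg, fun U => ?_, ?_⟩
  · have := hgU U
    push_cast at this
    exact this
  · refine (ENNReal.ofReal_le_ofReal hgi).trans (ENNReal.ofReal_add_le.trans ?_)
    refine add_le_add le_rfl (le_trans (ENNReal.ofReal_le_ofReal ?_) hxy)
    exact mul_le_mul_of_nonneg_right hp (by positivity)

end Main

end Decoupling

end

theorem mainTheorem2 (k : ℕ) (hk : 0 < k)
    (A : Fin k → Type*) [∀ i, Fintype (A i)] [∀ i, DecidableEq (A i)]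
    (B R : Type*) [Fintype B] [DecidableEq B] [Fintype R] [DecidableEq R]
    (hA : ∀ i, 2 ≤ Fintype.card (A i))
    (T : Matrix (∀ i, A i) (∀ i, A i) ℂ →ₗ[ℂ] Matrix B B ℂ)
    (hT : Decoupling.IsCompletelyPositive T) (hT' : Decoupling.IsTraceNonincreasing T)
    (ρ : Matrix ((∀ i, A i) × R) ((∀ i, A i) × R) ℂ) (hρ : Decoupling.IsSubnormalised ρ)
    (ε : ℝ) (hε₀ : 0 < ε) (hε₁ : ε < 1) :
    ∫⁻ U : (∀ i, Matrix.unitaryGroup (A i) ℂ),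
        ENNReal.ofReal (Decoupling.schattenNorm 1
          (Decoupling.perturbedState T ρ U -
            Decoupling.traceFst (Decoupling.choiState T) ⊗ₖ Decoupling.traceFst ρ))
        ∂(Measure.pi fun i => Decoupling.haarUnitary (A i)) ≤
      ENNReal.ofReal (2 * (3 ^ k - 1) * ε) +
        ∑ S : Finset (Fin k) with S.Nonempty,
          ENNReal.ofReal (2 ^ S.card * Decoupling.coeffD A S) *
            Decoupling.epow2
              (-((1 / 2 : ℝ) : EReal) *
                  Decoupling.smoothCondEntropy ε (Decoupling.marginal S ρ) -
                ((1 / 2 : ℝ) : EReal) *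
                  Decoupling.smoothCondEntropy ε
                    (Decoupling.marginal S (Decoupling.choiState T))) := by
  open Decoupling in
  have hτ := isSubnormalised_choiState hA hT hT'
  refine ENNReal.le_of_forall_pos_le_add fun δ hδ _ => ?_
  have hδ' : (0 : ℝ) < δ / 2 ^ k := by positivity
  have key : ∀ S : Finset (Fin k), ∃ g : (∀ i, Matrix.unitaryGroup (A i) ℂ) → ℝ,
      S.Nonempty → _ := fun S => by
    by_cases hS : S.Nonempty
    · obtain ⟨g, hg⟩ := exists_continuous_bound_entropy hA hτ hρ hε₀.le hδ' hS
      exact ⟨g, fun _ => hg⟩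
    · exact ⟨0, fun h => absurd h hS⟩
  choose g hg using key
  have hmem : ∀ S ∈ Finset.univ.filter fun S : Finset (Fin k) => S.Nonempty, S.Nonempty :=
    fun S hS => (Finset.mem_filter.1 hS).2
  have hH : ∀ (S : Finset (Fin k)) (U : ∀ i, Matrix.unitaryGroup (A i) ℂ),
      ((∏ i : {i // i ∈ S}, (Fintype.card (A i) : ℂ)) • link (marginal S (choiState T))
        (centredProd S U) (marginal S ρ)).IsHermitian := fun S U => by
    have h := isHermitian_link (isSubnormalised_marginal S hτ).1.isHermitian
      (isHermitian_centredProd S U) (isSubnormalised_marginal S hρ).1.isHermitian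
    rw [Matrix.IsHermitian, Matrix.conjTranspose_smul, h.eq]
    simp
  have hgi : ∀ S ∈ Finset.univ.filter fun S : Finset (Fin k) => S.Nonempty,
      Integrable (g S) (piHaar A) := fun S hS =>
    integrable_piHaar_of_continuous (hg S (hmem S hS)).1
  calc _ ≤ ∫⁻ U, ENNReal.ofReal (∑ S : Finset (Fin k) with S.Nonempty, g S U) ∂piHaar A := by
        refine lintegral_mono fun U => ENNReal.ofReal_le_ofReal ?_
        rw [perturbedState_sub_eq hA]
        exact (schattenNorm_one_sum_le _ fun S _ => hH S U).trans
          (Finset.sum_le_sum fun S hS => (hg S (hmem S hS)).2.1 U)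
    _ = ENNReal.ofReal (∑ S : Finset (Fin k) with S.Nonempty, ∫ U, g S U ∂piHaar A) := by
        rw [← integral_finsetSum _ hgi, ofReal_integral_eq_lintegral_ofReal
          (integrable_finsetSum _ hgi) (Filter.Eventually.of_forall fun U =>
            Finset.sum_nonneg fun S hS =>
              (schattenNorm_one_nonneg (hH S U)).trans ((hg S (hmem S hS)).2.1 U))]
    _ ≤ ∑ S : Finset (Fin k) with S.Nonempty, ENNReal.ofReal (∫ U, g S U ∂piHaar A) :=
        Finset.le_sum_of_subadditive _ ENNReal.ofReal_zero.le
          (fun _ _ => ENNReal.ofReal_add_le) _ _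
    _ ≤ _ := Finset.sum_le_sum fun S hS => (hg S (hmem S hS)).2.2
    _ ≤ _ := by
        rw [Finset.sum_add_distrib, Finset.sum_add_distrib, ← add_assoc,
          ← ENNReal.ofReal_sum_of_nonneg fun S _ => by positivity, ← Finset.sum_mul,
          ← Finset.mul_sum, sum_two_pow_card, Finset.sum_const]
        refine add_le_add le_rfl ?_
        calc _ ≤ (2 ^ k) • ENNReal.ofReal (δ / 2 ^ k) := by
              refine nsmul_le_nsmul_left zero_le ?_
              refine (Finset.card_le_univ _).trans_eq ?_
              simp
          _ = δ := by
              rw [← ENNReal.ofReal_nsmul, nsmul_eq_mul]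
              push_cast
              rw [mul_div_cancel₀ _ (by positivity), ENNReal.ofReal_coe_nnreal]
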